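/- Let $d\ge 1$ and $T\in\mathbb N$, $T\ge 1$. Let $\mathcal L\subset\mathbb R^d$ be such that (L1) there is $r>0$ with $|x-y|\ge r$ for all distinct $x,y\in\mathcal L$, and (L2) $\mathcal L+Tz=\mathcal L$ for all $z\in\mathbb Z^d$. Let $c_{i,j}\in[0,\infty)$, $i,j\in\mathcal L$, be such that (H1) $c_{i+Tz,j+Tz}=c_{i,j}$ for all $i,j\in\mathcal L$, $z\in\mathbb Z^d$, and (H3) there is $R>1$ with $c_{i,j}=0$ whenever $|i-j|\ge R$. For $u\colon\mathcal L\to\mathbb R$ and $A\subset\mathbb R^d$ put $E(u,A)=\sum_{i\in\mathcal L\cap A}\sum_{j\in\mathcal L}c_{i,j}(u(i)-u(j))^+$. Let $Q_\rho=[-\rho/2,\rho/2)^d$; for each unit vector $\nu$ fix a linear isometry $R^\nu$ of $\mathbb R^d$ with $R^\nu e_d=\nu$, and put $Q^\nu_\rho=R^\nu Q_\rho$ and $u_\nu(x)=1$ if $\langle\nu,x\rangle\ge 0$, $u_\nu(x)=0$ otherwise. Then there is exactly one convex, positively one-homogeneous function $\varphi\colon\mathbb R^d\to[0,\infty)$ (the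 homogenized surface energy density) such that for all unit vectors $\nu$ the following limits exist (the inner one for every $\delta\in(0,1)$) and $$\varphi(\nu)=\lim_{\delta\to0^+}\lim_{S\to+\infty}\frac1{S^{d-1}}\inf\{E(u,Q^\nu_S): u\colon\mathcal L\to\{0,1\},\ u=u_\nu\text{ on }\mathcal L\setminus Q^\nu_{(1-\delta)S}\}.$$ Let $W_\varphi=\{\zeta\in\mathbb R^d:\langle\zeta,\nu\rangle\le\varphi(\nu)\text{ for all }|\nu|=1\}$ be its Wulff set and $\mathcal E=\{(i,j)\in(\mathcal L\cap Q_T)\times\mathcal L:c_{i,j}\ne0\}$. Then: 1. $\varphi$ is crystalline, i.e. $W_\varphi$ is a polytope (the convex hull of a finite set). 2. $N=\#\mathcal E$ is finite and $W_\varphi$ has at most $3^N$ extreme points. 3. For all $\nu\in\mathbb R^d$, $\varphi(\nu)=\sup_{\alpha\in\mathcal C}\big\langle\nu,\frac1{T^d}\sum_{i\in\mathcal L\cap Q_T}\sum_{j\in\mathcal L}\alpha_{i,j}(i-j)\big\rangle$, where $\mathcal C$ is the set of all $\alpha\colon\mathcal L\times\mathcal L\to\mathbb R$ with $0\le\alpha_{i,j}\le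 c_{i,j}$ and $\alpha_{i+Tz,j+Tz}=\alpha_{i,j}$ for all $i,j\in\mathcal L$, $z\in\mathbb Z^d$, and $\sum_{j\in\mathcal L}(\alpha_{j,i}-\alpha_{i,j})=0$ for all $i\in\mathcal L\cap Q_T$. 4. $W_\varphi=\Lambda\big(V\cap\prod_{(i,j)\in\mathcal E}[0,c_{i,j}]\big)$, where $\Lambda\colon\mathbb R^{\mathcal E}\to\mathbb R^d$ is the linear map $\Lambda\beta=\frac1{T^d}\sum_{(i,j)\in\mathcal E}\beta_{i,j}(i-j)$ and $V\subset\mathbb R^{\mathcal E}$ is the linear subspace of all $\beta$ whose extension $\alpha$ to $\mathcal L\times\mathcal L$ by $T$-periodicity, and by $0$ where $c$ vanishes, satisfies $\sum_{j\in\mathcal L}(\alpha_{j,i}-\alpha_{i,j})=0$ for all $i\in\mathcal L\cap Q_T$. -/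

import Mathlib

open scoped NNReal ENNReal Topology

noncomputable section

namespace LatticeEnergy

/-- The ambient space `ℝ^d`, written with `d = n + 1 ≥ 1`. -/
abbrev Space (n : ℕ) : Type := EuclideanSpace ℝ (Fin (n + 1))

/-- The vector `T z` for `z ∈ ℤ^d`. -/
def shift {n : ℕ} (T : ℕ) (z : Fin (n + 1) → ℤ) : Space n :=
  WithLp.toLp 2 fun k => (T : ℝ) * (z k : ℝ)

/-- The last standard basis vector `e_d`. -/
def lastBasisVector (n : ℕ) : Space n := EuclideanSpace.single (Fin.last n) (1 : ℝ)

/-- The half-open cube `Q_ρ = [-ρ/2, ρ/2)^d`. -/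
def cube (n : ℕ) (ρ : ℝ) : Set (Space n) :=
  {x | ∀ k, -(ρ / 2) ≤ x k ∧ x k < ρ / 2}

/-- The image of the cube `Q_ρ` under the linear isometry `U`. -/
def rotatedCube {n : ℕ} (U : Space n ≃ₗᵢ[ℝ] Space n) (ρ : ℝ) : Set (Space n) :=
  U '' cube n ρ

/-- (L1): distinct points of `L` have distance at least some `r > 0`. -/
def IsDiscreteSet {n : ℕ} (L : Set (Space n)) : Prop :=
  ∃ r : ℝ, 0 < r ∧ ∀ x ∈ L, ∀ y ∈ L, x ≠ y → r ≤ dist x y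

/-- (L2): `L + T z = L` for all `z ∈ ℤ^d`. -/
def IsPeriodicSet {n : ℕ} (T : ℕ) (L : Set (Space n)) : Prop :=
  ∀ z : Fin (n + 1) → ℤ, (fun x => x + shift T z) '' L = L

/-- (H1): `a (i + T z) (j + T z) = a i j` for all `i, j ∈ L`, `z ∈ ℤ^d`. -/
def IsPeriodicKernel {n : ℕ} {X : Type} (T : ℕ) {L : Set (Space n)} (a : L → L → X) : Prop :=
  ∀ (z : Fin (n + 1) → ℤ) (i j i' j' : L),
    (i' : Space n) = i + shift T z → (j' : Space n) = j + shift T z → a i' j' = a i j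

/-- (H3): finite range of interaction. -/
def HasFiniteRange {n : ℕ} {L : Set (Space n)} (c : L → L → ℝ≥0) : Prop :=
  ∃ R : ℝ, 1 < R ∧ ∀ i j : L, R ≤ dist (i : Space n) (j : Space n) → c i j = 0

/-- `E(u, A) = ∑_{i ∈ L ∩ A} ∑_{j ∈ L} c_{ij} (u i - u j)^+`, with values in `[0, ∞]`;
`ENNReal.ofReal` takes the positive part. -/
def energy {n : ℕ} {L : Set (Space n)} (c : L → L → ℝ≥0) (u : L → ℝ) (A : Set (Space n)) : ℝ≥0∞ :=
  ∑' i : {i : L // (i : Space n) ∈ A}, ∑' j : L, (c i.1 j : ℝ≥0∞) * ENNReal.ofReal (u i.1 - u j)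

open Classical in
/-- The indicator of the half-space `⟨ν, x⟩ ≥ 0`. -/
def halfSpaceIndicator {n : ℕ} (ν x : Space n) : ℝ :=
  if 0 ≤ inner ℝ ν x then 1 else 0

/-- The functions `u : L → {0,1}` that agree with the half-space indicator of `ν`
outside the rotated cube of side-length `(1 - δ) S`. -/
def competitors {n : ℕ} (L : Set (Space n)) (U : Space n ≃ₗᵢ[ℝ] Space n) (ν : Space n)
    (δ S : ℝ) : Set (L → ℝ) :=
  {u | (∀ i, u i = 0 ∨ u i = 1) ∧
    ∀ i : L, (i : Space n) ∉ rotatedCube U ((1 - δ) * S) → u i = halfSpaceIndicator ν i}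

/-- The normalized minimal energy `S^{-(d-1)} inf E(u, Q^ν_S)` over the competitors. -/
def cellEnergy {n : ℕ} {L : Set (Space n)} (c : L → L → ℝ≥0) (U : Space n ≃ₗᵢ[ℝ] Space n)
    (ν : Space n) (δ S : ℝ) : ℝ≥0∞ :=
  (⨅ u ∈ competitors L U ν δ S, energy c u (rotatedCube U S)) / ENNReal.ofReal (S ^ n)

/-- `φ` is the homogenized surface energy density of `c`: it is nonnegative, convex, positively
homogeneous of degree one, and for every unit vector `ν` the iterated limit
`lim_{δ → 0+} lim_{S → ∞}` of the cell energies exists and equals `φ ν`.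
Here `rot ν` is the chosen linear isometry that maps `e_d` to `ν`. -/
structure IsHomogenizedDensity {n : ℕ} {L : Set (Space n)} (c : L → L → ℝ≥0)
    (rot : Space n → Space n ≃ₗᵢ[ℝ] Space n) (φ : Space n → ℝ) : Prop where
  nonneg : ∀ ν, 0 ≤ φ ν
  convex : ConvexOn ℝ Set.univ φ
  homogeneous : ∀ (t : ℝ) (ν : Space n), 0 < t → φ (t • ν) = t * φ ν
  cell_formula : ∀ ν : Space n, ‖ν‖ = 1 → ∃ g : ℝ → ℝ≥0∞,
    (∀ δ : ℝ, 0 < δ → δ < 1 →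
      Filter.Tendsto (fun S : ℝ => cellEnergy c (rot ν) ν δ S) Filter.atTop (𝓝 (g δ))) ∧
    Filter.Tendsto g (𝓝[>] 0) (𝓝 (ENNReal.ofReal (φ ν)))

/-- The Wulff set of `φ`. -/
def wulffSet {n : ℕ} (φ : Space n → ℝ) : Set (Space n) :=
  {ζ | ∀ ν : Space n, ‖ν‖ = 1 → inner ℝ ζ ν ≤ φ ν}

/-- A polytope is the convex hull of a finite set. -/
def IsPolytope {n : ℕ} (W : Set (Space n)) : Prop :=
  ∃ s : Set (Space n), s.Finite ∧ W = convexHull ℝ s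

/-- `φ` is crystalline if its Wulff set is a polytope. -/
def IsCrystalline {n : ℕ} (φ : Space n → ℝ) : Prop := IsPolytope (wulffSet φ)

/-- The edges `{(i, j) ∈ (L ∩ Q_T) × L : c_{ij} ≠ 0}`. -/
def edges {n : ℕ} (T : ℕ) {L : Set (Space n)} (c : L → L → ℝ≥0) : Set (L × L) :=
  {e | (e.1 : Space n) ∈ cube n T ∧ c e.1 e.2 ≠ 0}

/-- `∑_{j ∈ L} (α_{ji} - α_{ij}) = 0` for all `i ∈ L ∩ Q_T`. (Used only for `α` that vanish
where a finite range `c` vanishes, so that the sums are finite.) -/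
def IsDivergenceFree {n : ℕ} (T : ℕ) {L : Set (Space n)} (α : L → L → ℝ) : Prop :=
  ∀ i : L, (i : Space n) ∈ cube n T → ∑' j : L, (α j i - α i j) = 0

/-- The periodic divergence-free fluxes `α` with `0 ≤ α_{ij} ≤ c_{ij}`. -/
def admissibleFluxes {n : ℕ} (T : ℕ) {L : Set (Space n)} (c : L → L → ℝ≥0) :
    Set (L → L → ℝ) :=
  {α | (∀ i j, 0 ≤ α i j ∧ α i j ≤ c i j) ∧ IsPeriodicKernel T α ∧ IsDivergenceFree T α}

/-- `T^{-d} ∑_{i ∈ L ∩ Q_T} ∑_{j ∈ L} α_{ij} (i - j)`. -/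
def meanFlux {n : ℕ} (T : ℕ) {L : Set (Space n)} (α : L → L → ℝ) : Space n :=
  ((T : ℝ) ^ (n + 1))⁻¹ •
    ∑' i : {i : L // (i : Space n) ∈ cube n T}, ∑' j : L, α i.1 j • ((i.1 : Space n) - j)

/-- The vectors `β ∈ ℝ^N`, indexed by the edges, whose `T`-periodic extension to `L × L`
(by zero where `c` vanishes) is divergence-free. -/
def divergenceFreeVectors {n : ℕ} (T : ℕ) {L : Set (Space n)} (c : L → L → ℝ≥0) :
    Set (edges T c → ℝ) :=
  {β | ∃ α : L → L → ℝ, (∀ i j, c i j = 0 → α i j = 0) ∧ IsPeriodicKernel T α ∧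
    (∀ e : edges T c, β e = α e.1.1 e.1.2) ∧ IsDivergenceFree T α}

end LatticeEnergy

end

/-!
The translations `T ℤ^d` turn the interaction into a finite graph whose edges carry capacities
`c` and displacements `i - j`. A circulation below the capacities calibrates: its flux through the
boundary of a set does not depend on the set away from the boundary of the cube, which bounds the
cell energy from below. Conversely, adding a periodic potential `q` to the height `⟨ν, ·⟩` before
thresholding gives a competitor, and averaging over the threshold shows that some threshold
achieves the mean of `c (⟨ν, i - j⟩ + q i - q j)^+`. Linear programming duality identifies the
maximal flux of a circulation with the minimum over the potentials, so `φ` is the support function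
of a linear image of `V ∩ ∏ [0, c]`. An extreme point of this image lifts to an extreme point of
`V ∩ ∏ [0, c]`, and such a point is determined by the coordinates at which it meets the lower
bound, the upper bound, or neither; this gives the factor `3 ^ N`.
-/

open Filter

noncomputable section

namespace LatticeEnergy

variable {n T : ℕ}

/-! ### Cells and rotated boxes -/

/-- The embedding `z ↦ T z` of `ℤ^d` into `ℝ^d` as a homomorphism. -/
def shiftHom (T : ℕ) : (Fin (n + 1) → ℤ) →+ Space n :=
  AddMonoidHom.mk' (shift T) fun z w => by ext k; simp [shift, mul_add]

theorem shift_add (T : ℕ) (z w : Fin (n + 1) → ℤ) : shift T (z + w) = shift T z + shift T w :=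
  map_add (shiftHom T) z w

theorem shift_sub (T : ℕ) (z w : Fin (n + 1) → ℤ) : shift T (z - w) = shift T z - shift T w :=
  map_sub (shiftHom T) z w

theorem shift_zero (T : ℕ) : shift T (0 : Fin (n + 1) → ℤ) = 0 :=
  map_zero (shiftHom T)

theorem shift_neg (T : ℕ) (z : Fin (n + 1) → ℤ) : shift T (-z) = -shift T z :=
  map_neg (shiftHom T) z

theorem shift_nsmul (T M : ℕ) (z : Fin (n + 1) → ℤ) : shift T (M • z) = (M : ℝ) • shift T z := by
  rw [Nat.cast_smul_eq_nsmul]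
  exact map_nsmul (shiftHom T) M z

/-- The height of a point in the direction `U e_d`. -/
def height (U : Space n ≃ₗᵢ[ℝ] Space n) : Space n →L[ℝ] ℝ :=
  (EuclideanSpace.proj (Fin.last n)).comp (U.symm.toContinuousLinearEquiv : Space n →L[ℝ] Space n)

theorem height_apply (U : Space n ≃ₗᵢ[ℝ] Space n) (x : Space n) :
    height U x = U.symm x (Fin.last n) := rfl

theorem height_eq_inner {U : Space n ≃ₗᵢ[ℝ] Space n} {ν : Space n}
    (hU : U (lastBasisVector n) = ν) (x : Space n) : height U x = inner ℝ ν x := by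
  rw [← hU, ← U.symm.inner_map_map]
  simp [lastBasisVector, height_apply, EuclideanSpace.inner_single_left]

theorem abs_symm_apply_le (U : Space n ≃ₗᵢ[ℝ] Space n) (x : Space n) (k : Fin (n + 1)) :
    |U.symm x k| ≤ ‖x‖ := by
  simpa using PiLp.norm_apply_le (U.symm x) k

theorem abs_height_le (U : Space n ≃ₗᵢ[ℝ] Space n) (x : Space n) : |height U x| ≤ ‖x‖ :=
  abs_symm_apply_le U x _

/-- The rotated box with lateral side `ρ` and heights in `[a, b)`. -/
def slab (U : Space n ≃ₗᵢ[ℝ] Space n) (a b ρ : ℝ) : Set (Space n) :=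
  {x | (∀ k : Fin n, -(ρ / 2) ≤ U.symm x k.castSucc ∧ U.symm x k.castSucc < ρ / 2) ∧
    a ≤ height U x ∧ height U x < b}

section Slab

variable {U : Space n ≃ₗᵢ[ℝ] Space n} {a b a' b' ρ ρ' r : ℝ} {x v : Space n}

theorem rotatedCube_eq_slab (U : Space n ≃ₗᵢ[ℝ] Space n) (ρ : ℝ) :
    rotatedCube U ρ = slab U (-(ρ / 2)) (ρ / 2) ρ := by
  ext x
  rw [rotatedCube, LinearIsometryEquiv.image_eq_preimage_symm]
  exact Fin.forall_fin_succ'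

theorem cube_eq_slab (ρ : ℝ) :
    cube n ρ = slab (LinearIsometryEquiv.refl ℝ _) (-(ρ / 2)) (ρ / 2) ρ := by
  rw [← rotatedCube_eq_slab, rotatedCube]
  simp

theorem slab_mono (ha : a' ≤ a) (hb : b ≤ b') (hρ : ρ ≤ ρ') : slab U a b ρ ⊆ slab U a' b' ρ' := by
  rintro x ⟨h, h1, h2⟩
  exact ⟨fun k => ⟨by linarith [(h k).1], by linarith [(h k).2]⟩, by linarith, by linarith⟩

theorem rotatedCube_mono (h : ρ ≤ ρ') : rotatedCube U ρ ⊆ rotatedCube U ρ' := by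
  rw [rotatedCube_eq_slab, rotatedCube_eq_slab]
  exact slab_mono (by linarith) (by linarith) h

theorem mem_slab_iff_mem_rotatedCube (ha : -(ρ / 2) ≤ a) (hb : b ≤ ρ / 2) :
    x ∈ slab U a b ρ ↔ x ∈ rotatedCube U ρ ∧ a ≤ height U x ∧ height U x < b := by
  rw [rotatedCube_eq_slab]
  exact ⟨fun ⟨h, h1, h2⟩ => ⟨⟨h, ha.trans h1, h2.trans_le hb⟩, h1, h2⟩,
    fun ⟨⟨h, _⟩, h1⟩ => ⟨h, h1⟩⟩

theorem add_mem_slab (hx : x ∈ slab U a b ρ) (hv : ‖v‖ ≤ r) :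
    x + v ∈ slab U (a + height U v) (b + height U v) (ρ + 2 * r) := by
  refine ⟨fun k => ?_, ?_, ?_⟩
  · have hk := hx.1 k
    have hvk := abs_le.1 ((abs_symm_apply_le U v k.castSucc).trans hv)
    simp only [map_add, PiLp.add_apply]
    constructor <;> linarith
  · rw [map_add]; linarith [hx.2.1]
  · rw [map_add]; linarith [hx.2.2]

theorem add_mem_slab_of_norm_le (hx : x ∈ slab U a b ρ) (hv : ‖v‖ ≤ r) :
    x + v ∈ slab U (a - r) (b + r) (ρ + 2 * r) := by
  have h := abs_le.1 ((abs_height_le U v).trans hv)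
  exact slab_mono (by linarith) (by linarith) le_rfl (add_mem_slab hx hv)

theorem add_mem_rotatedCube (hx : x ∈ rotatedCube U ρ) (hv : ‖v‖ ≤ r) :
    x + v ∈ rotatedCube U (ρ + 2 * r) := by
  rw [rotatedCube_eq_slab] at hx ⊢
  exact slab_mono (by linarith) (by linarith) le_rfl (add_mem_slab_of_norm_le hx hv)

theorem norm_le_of_mem_cube (hv : v ∈ cube n ρ) : ‖v‖ ≤ (n + 1) * ρ := by
  have hρ : 0 ≤ ρ := by linarith [(hv 0).1, (hv 0).2]
  have hcoord : ∀ k, ‖v k‖ ≤ ρ := fun k =>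
    abs_le.2 ⟨by linarith [(hv k).1], by linarith [(hv k).2]⟩
  rw [EuclideanSpace.norm_eq]
  refine Real.sqrt_le_iff.2 ⟨by positivity, ?_⟩
  calc ∑ k, ‖v k‖ ^ 2 ≤ (∑ k, ‖v k‖) ^ 2 :=
        Finset.sum_sq_le_sq_sum_of_nonneg fun k _ => norm_nonneg _
    _ ≤ (∑ _k : Fin (n + 1), ρ) ^ 2 := by gcongr with k; exact hcoord k
    _ = ((n + 1) * ρ) ^ 2 := by simp

theorem norm_le_of_mem_rotatedCube (hx : x ∈ rotatedCube U ρ) : ‖x‖ ≤ (n + 1) * ρ := by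
  obtain ⟨v, hv, rfl⟩ := hx
  rw [U.norm_map]
  exact norm_le_of_mem_cube hv

theorem isBounded_rotatedCube (U : Space n ≃ₗᵢ[ℝ] Space n) (ρ : ℝ) :
    Bornology.IsBounded (rotatedCube U ρ) :=
  isBounded_iff_forall_norm_le.2 ⟨_, fun _ => norm_le_of_mem_rotatedCube⟩

theorem isBounded_cube (ρ : ℝ) : Bornology.IsBounded (cube n ρ) :=
  isBounded_iff_forall_norm_le.2 ⟨_, fun _ => norm_le_of_mem_cube⟩

theorem isBounded_slab (U : Space n ≃ₗᵢ[ℝ] Space n) (a b ρ : ℝ) :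
    Bornology.IsBounded (slab U a b ρ) := by
  set σ := |ρ| + 2 * |a| + 2 * |b|
  refine (isBounded_rotatedCube U σ).subset ?_
  rw [rotatedCube_eq_slab]
  have ha := neg_abs_le a
  have hb := le_abs_self b
  have hρ := le_abs_self ρ
  have := abs_nonneg a
  have := abs_nonneg b
  have := abs_nonneg ρ
  apply slab_mono <;> linarith

theorem slab_eq_preimage (U : Space n ≃ₗᵢ[ℝ] Space n) (a b ρ : ℝ) :
    slab U a b ρ = U.symm ⁻¹' ((MeasurableEquiv.toLp 2 (Fin (n + 1) → ℝ)).symm ⁻¹'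
      (Set.univ.pi fun k => Set.Ico (Fin.snoc (α := fun _ => ℝ) (fun _ => -(ρ / 2)) a k)
        (Fin.snoc (α := fun _ => ℝ) (fun _ => ρ / 2) b k))) := by
  ext x
  simp [slab, height_apply, Set.mem_pi, Fin.forall_fin_succ']

theorem measurableSet_slab (U : Space n ≃ₗᵢ[ℝ] Space n) (a b ρ : ℝ) :
    MeasurableSet (slab U a b ρ) := by
  rw [slab_eq_preimage]
  exact ((MeasurableSet.univ_pi fun k => measurableSet_Ico).preimage
    (MeasurableEquiv.measurable _)).preimage U.symm.continuous.measurable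

theorem volume_slab (U : Space n ≃ₗᵢ[ℝ] Space n) (a b : ℝ) (hρ : 0 ≤ ρ) :
    MeasureTheory.volume (slab U a b ρ) = ENNReal.ofReal (ρ ^ n * (b - a)) := by
  have hbox : MeasurableSet (Set.univ.pi fun k : Fin (n + 1) =>
      Set.Ico (Fin.snoc (α := fun _ => ℝ) (fun _ => -(ρ / 2)) a k)
        (Fin.snoc (α := fun _ => ℝ) (fun _ => ρ / 2) b k)) :=
    MeasurableSet.univ_pi fun k => measurableSet_Ico
  rw [slab_eq_preimage, U.symm.measurePreserving.measure_preimage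
    (hbox.preimage (MeasurableEquiv.measurable _)).nullMeasurableSet,
    (EuclideanSpace.volume_preserving_symm_measurableEquiv_toLp _).measure_preimage
    hbox.nullMeasurableSet, Real.volume_pi_Ico, Fin.prod_univ_castSucc]
  simp [ENNReal.ofReal_mul (pow_nonneg hρ n), ENNReal.ofReal_pow hρ]

end Slab

section Lattice

variable [NeZero T]

/-- The index `z` of the cell `T z + Q_T` that contains `x`. -/
def cellIndex (T : ℕ) (x : Space n) : Fin (n + 1) → ℤ := fun k => ⌊(x k + T / 2) / T⌋

theorem sub_shift_mem_cube_iff (x : Space n) (z : Fin (n + 1) → ℤ) :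
    x - shift T z ∈ cube n T ↔ z = cellIndex T x := by
  have hT : (0 : ℝ) < T := Nat.cast_pos.2 (NeZero.pos T)
  rw [funext_iff]
  refine forall_congr' fun k => ?_
  rw [cellIndex, eq_comm, Int.floor_eq_iff, le_div_iff₀ hT, div_lt_iff₀ hT, PiLp.sub_apply, shift]
  constructor <;> rintro ⟨h1, h2⟩ <;> constructor <;> linarith

theorem sub_shift_cellIndex_mem (x : Space n) : x - shift T (cellIndex T x) ∈ cube n T :=
  (sub_shift_mem_cube_iff x _).2 rfl

theorem cellIndex_add_shift {x : Space n} (hx : x ∈ cube n T) (z : Fin (n + 1) → ℤ) :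
    cellIndex T (x + shift T z) = z :=
  ((sub_shift_mem_cube_iff _ _).1 (by rwa [add_sub_cancel_right])).symm

/-! ### Counting lattice points -/

theorem finite_setOf_add_shift_mem {A : Set (Space n)} (hA : Bornology.IsBounded A)
    (x : Space n) : {z | x + shift T z ∈ A}.Finite := by
  obtain ⟨C, hC⟩ := isBounded_iff_forall_norm_le.1 hA
  refine (Set.finite_Icc (fun _ : Fin (n + 1) => -⌈C + ‖x‖⌉) (fun _ => ⌈C + ‖x‖⌉)).subset
    fun z hz => ?_
  have hnorm : ‖shift T z‖ ≤ C + ‖x‖ := by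
    simpa using (norm_sub_le (x + shift T z) x).trans (add_le_add_left (hC _ hz) _)
  have hcoord : ∀ k, |z k| ≤ ⌈C + ‖x‖⌉ := fun k => by
    have hT : (1 : ℝ) ≤ T := Nat.one_le_cast.2 (NeZero.pos T)
    have hk : T * |(z k : ℝ)| ≤ C + ‖x‖ := by
      simpa [shift, abs_mul] using (PiLp.norm_apply_le (shift T z) k).trans hnorm
    have : |(z k : ℝ)| ≤ ⌈C + ‖x‖⌉ :=
      (le_mul_of_one_le_left (abs_nonneg _) hT).trans (hk.trans (Int.le_ceil _))
    exact_mod_cast this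
  exact ⟨fun k => (abs_le.1 (hcoord k)).1, fun k => (abs_le.1 (hcoord k)).2⟩

open Classical in
/-- The indices `z` such that `x + T z` lies in `A`; this is the junk value `∅` if there are
infinitely many of them, so `A` should be bounded. -/
def latticePoints (T : ℕ) (A : Set (Space n)) (x : Space n) : Finset (Fin (n + 1) → ℤ) :=
  if h : {z | x + shift T z ∈ A}.Finite then h.toFinset else ∅

section LatticePoints

variable {U : Space n ≃ₗᵢ[ℝ] Space n} {a b a' b' ρ ρ' : ℝ} {x : Space n} {z : Fin (n + 1) → ℤ}

theorem mem_latticePoints {A : Set (Space n)} (hA : Bornology.IsBounded A) :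
    z ∈ latticePoints T A x ↔ x + shift T z ∈ A := by
  simp [latticePoints, finite_setOf_add_shift_mem hA x]

theorem mem_latticePoints_slab :
    z ∈ latticePoints T (slab U a b ρ) x ↔ x + shift T z ∈ slab U a b ρ :=
  mem_latticePoints (isBounded_slab U a b ρ)

theorem mem_latticePoints_rotatedCube :
    z ∈ latticePoints T (rotatedCube U ρ) x ↔ x + shift T z ∈ rotatedCube U ρ :=
  mem_latticePoints (isBounded_rotatedCube U ρ)

theorem latticePoints_mono {A B : Set (Space n)} (hAB : A ⊆ B) (hB : Bornology.IsBounded B)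
    (x : Space n) : latticePoints T A x ⊆ latticePoints T B x := fun _ hz =>
  (mem_latticePoints hB).2 (hAB ((mem_latticePoints (hB.subset hAB)).1 hz))

/-- The cell of side `T` centred at `x + T z`. -/
def latticeCell (T : ℕ) (x : Space n) (z : Fin (n + 1) → ℤ) : Set (Space n) :=
  (fun y => y - (x + shift T z)) ⁻¹' cube n T

theorem volume_biUnion_latticeCell (x : Space n) (Z : Finset (Fin (n + 1) → ℤ)) :
    MeasureTheory.volume (⋃ z ∈ Z, latticeCell T x z) = ENNReal.ofReal (Z.card * T ^ (n + 1)) := by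
  have hcube : MeasurableSet (cube n T) := by
    rw [cube_eq_slab]
    exact measurableSet_slab _ _ _ _
  have hdisj : (Z : Set (Fin (n + 1) → ℤ)).PairwiseDisjoint (latticeCell T x) := by
    intro z _ w _ hzw
    refine Set.disjoint_left.2 fun y hy hy' => hzw ?_
    rw [latticeCell, Set.mem_preimage, ← sub_sub] at hy hy'
    rw [(sub_shift_mem_cube_iff _ _).1 hy, (sub_shift_mem_cube_iff _ _).1 hy']
  have hvol : ∀ z ∈ Z, MeasureTheory.volume (latticeCell T x z) =
      ENNReal.ofReal ((T : ℝ) ^ (n + 1)) := fun z _ => by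
    rw [latticeCell, (MeasureTheory.measurePreserving_sub_right _ _).measure_preimage
      hcube.nullMeasurableSet, cube_eq_slab, volume_slab _ _ _ (Nat.cast_nonneg _)]
    congr 1
    ring
  rw [MeasureTheory.measure_biUnion_finset hdisj fun z _ => hcube.preimage (by fun_prop),
    Finset.sum_congr rfl hvol, Finset.sum_const, nsmul_eq_mul, ← ENNReal.ofReal_natCast,
    ← ENNReal.ofReal_mul (Nat.cast_nonneg _)]

/-- The number of points of `x + T ℤ^d` in the slab. -/
def slabCount (T : ℕ) (U : Space n ≃ₗᵢ[ℝ] Space n) (x : Space n) (a b ρ : ℝ) : ℝ :=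
  (latticePoints T (slab U a b ρ) x).card

theorem slabCount_nonneg (T : ℕ) (U : Space n ≃ₗᵢ[ℝ] Space n) (x : Space n) (a b ρ : ℝ) :
    0 ≤ slabCount T U x a b ρ := Nat.cast_nonneg _

theorem slabCount_le (U : Space n ≃ₗᵢ[ℝ] Space n) (x : Space n) (hab : a ≤ b) (hρ : 0 ≤ ρ) :
    slabCount T U x a b ρ * T ^ (n + 1) ≤
      (ρ + 2 * ((n + 1) * T)) ^ n * (b - a + 2 * ((n + 1) * T)) := by
  set K : ℝ := (n + 1) * T
  have hK : 0 ≤ K := by positivity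
  have hsub : (⋃ z ∈ latticePoints T (slab U a b ρ) x, latticeCell T x z) ⊆
      slab U (a - K) (b + K) (ρ + 2 * K) := by
    refine Set.iUnion₂_subset fun z hz y hy => ?_
    simpa using add_mem_slab_of_norm_le (mem_latticePoints_slab.1 hz) (norm_le_of_mem_cube hy)
  have hvol := MeasureTheory.measure_mono (μ := MeasureTheory.volume) hsub
  rw [volume_biUnion_latticeCell, volume_slab _ _ _ (by positivity)] at hvol
  calc _ ≤ (ρ + 2 * K) ^ n * (b + K - (a - K)) :=
        (ENNReal.ofReal_le_ofReal_iff (mul_nonneg (by positivity) (by linarith))).1 hvol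
    _ = _ := by ring

theorem le_slabCount (U : Space n ≃ₗᵢ[ℝ] Space n) (x : Space n) (a b : ℝ)
    (hρ : 2 * ((n + 1) * T) ≤ ρ) :
    (ρ - 2 * ((n + 1) * T)) ^ n * (b - a - 2 * ((n + 1) * T)) ≤
      slabCount T U x a b ρ * T ^ (n + 1) := by
  set K : ℝ := (n + 1) * T
  have hsub : slab U (a + K) (b - K) (ρ - 2 * K) ⊆
      ⋃ z ∈ latticePoints T (slab U a b ρ) x, latticeCell T x z := by
    intro y hy
    set z := cellIndex T (y - x)
    have hcell : y - (x + shift T z) ∈ cube n T := by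
      rw [← sub_sub]
      exact sub_shift_cellIndex_mem (y - x)
    have hnorm : ‖x + shift T z - y‖ ≤ K := norm_sub_rev y _ ▸ norm_le_of_mem_cube hcell
    refine Set.mem_iUnion₂.2 ⟨z, mem_latticePoints_slab.2 ?_, hcell⟩
    simpa using add_mem_slab_of_norm_le hy hnorm
  have hvol := MeasureTheory.measure_mono (μ := MeasureTheory.volume) hsub
  rw [volume_biUnion_latticeCell, volume_slab _ _ _ (by linarith)] at hvol
  calc _ = (ρ - 2 * K) ^ n * (b - K - (a + K)) := by ring
    _ ≤ _ := (ENNReal.ofReal_le_ofReal_iff (by positivity)).1 hvol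

theorem slabCount_mono (U : Space n ≃ₗᵢ[ℝ] Space n) (x : Space n)
    (ha : a' ≤ a) (hb : b ≤ b') (hρ : ρ ≤ ρ') :
    slabCount T U x a b ρ ≤ slabCount T U x a' b' ρ' :=
  Nat.cast_le.2 <| Finset.card_le_card <|
    latticePoints_mono (slab_mono ha hb hρ) (isBounded_slab U a' b' ρ') x

theorem slabCount_of_le (U : Space n ≃ₗᵢ[ℝ] Space n) (x : Space n) (hba : b ≤ a) (ρ : ℝ) :
    slabCount T U x a b ρ = 0 := by
  rw [slabCount, Nat.cast_eq_zero, Finset.card_eq_zero, Finset.eq_empty_iff_forall_notMem]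
  intro z hz
  obtain ⟨-, h1, h2⟩ := mem_latticePoints_slab.1 hz
  linarith

theorem slabCount_add_slabCount (U : Space n ≃ₗᵢ[ℝ] Space n) (x : Space n) {a b c : ℝ}
    (hab : a ≤ b) (hbc : b ≤ c) (ρ : ℝ) :
    slabCount T U x a b ρ + slabCount T U x b c ρ = slabCount T U x a c ρ := by
  classical
  have hdisj : Disjoint (latticePoints T (slab U a b ρ) x) (latticePoints T (slab U b c ρ) x) :=
    Finset.disjoint_left.2 fun z h1 h2 => (mem_latticePoints_slab.1 h1).2.2.not_ge
      (mem_latticePoints_slab.1 h2).2.1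
  simp only [slabCount]
  rw [← Nat.cast_add, ← Finset.card_union_of_disjoint hdisj]
  congr 2
  ext z
  rw [Finset.mem_union, mem_latticePoints_slab, mem_latticePoints_slab, mem_latticePoints_slab]
  constructor
  · rintro (⟨h, h1, h2⟩ | ⟨h, h1, h2⟩)
    exacts [⟨h, h1, h2.trans_le hbc⟩, ⟨h, hab.trans h1, h2⟩]
  · rintro ⟨h, h1, h2⟩
    exact (lt_or_ge _ b).imp (fun h3 => ⟨h, h1, h3⟩) fun h3 => ⟨h, h3, h2⟩

theorem slabCount_le_add (U : Space n ≃ₗᵢ[ℝ] Space n) (x v : Space n) (a b ρ : ℝ) :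
    slabCount T U x a b ρ ≤
      slabCount T U (x + v) (a + height U v) (b + height U v) (ρ + 2 * ‖v‖) := by
  refine Nat.cast_le.2 <| Finset.card_le_card fun z hz => mem_latticePoints_slab.2 ?_
  rw [add_right_comm]
  exact add_mem_slab (mem_latticePoints_slab.1 hz) le_rfl

theorem slabCount_add_shift (U : Space n ≃ₗᵢ[ℝ] Space n) (x : Space n) (w : Fin (n + 1) → ℤ)
    (a b ρ : ℝ) : slabCount T U (x + shift T w) a b ρ = slabCount T U x a b ρ := by
  refine congrArg Nat.cast <| Finset.card_nbij' (fun z => z + w) (fun z => z - w) ?_ ?_ ?_ ?_ <;>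
    intro z <;>
    simp [mem_latticePoints_slab, shift_add, shift_sub, add_assoc, add_comm (shift T w)]

theorem slabCount_eq_sum {A : Set (Space n)} {a b : ℝ} (hA : Bornology.IsBounded A)
    (hslab : slab U a b ρ ⊆ A) (x : Space n) :
    slabCount T U x a b ρ =
      ∑ z ∈ latticePoints T A x, (slab U a b ρ).indicator 1 (x + shift T z) := by
  classical
  simp only [Set.indicator, Pi.one_apply]
  rw [← Finset.sum_filter, Finset.sum_const, nsmul_one, slabCount]
  congr 2
  ext z
  rw [Finset.mem_filter, mem_latticePoints hA, mem_latticePoints_slab]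
  exact ⟨fun h => ⟨hslab h, h⟩, And.right⟩

theorem slabCount_eq_sum_height {a b : ℝ} (ha : -(ρ / 2) ≤ a) (hb : b ≤ ρ / 2) (x : Space n) :
    slabCount T U x a b ρ =
      ∑ z ∈ latticePoints T (rotatedCube U ρ) x,
        (Set.Ico a b).indicator 1 (height U (x + shift T z)) := by
  rw [slabCount_eq_sum (isBounded_rotatedCube U ρ) fun _ hx =>
    ((mem_slab_iff_mem_rotatedCube ha hb).1 hx).1]
  refine Finset.sum_congr rfl fun z hz => ?_
  have hmem : x + shift T z ∈ slab U a b ρ ↔ height U (x + shift T z) ∈ Set.Ico a b :=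
    (mem_slab_iff_mem_rotatedCube ha hb).trans
      (and_iff_right (mem_latticePoints_rotatedCube.1 hz))
  simp only [Set.indicator, hmem, Pi.one_apply]

end LatticePoints

end Lattice

/-! ### Densities of lattice points in slabs -/

section Density

variable [NeZero T] {U : Space n ≃ₗᵢ[ℝ] Space n} {x : Space n} {a b c s l : ℝ}

/-- The group of heights of the lattice `T ℤ^d` in the direction `U e_d`. -/
def heightGroup (T : ℕ) (U : Space n ≃ₗᵢ[ℝ] Space n) : AddSubgroup ℝ :=
  ((height U : Space n →+ ℝ).comp (shiftHom T)).range

theorem height_shift_mem_heightGroup (T : ℕ) (U : Space n ≃ₗᵢ[ℝ] Space n)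
    (z : Fin (n + 1) → ℤ) : height U (shift T z) ∈ heightGroup T U := ⟨z, rfl⟩

theorem tendsto_affine_pow_div_pow (l k : ℝ) (n : ℕ) :
    Tendsto (fun ρ : ℝ => (l * ρ + k) ^ n / ρ ^ n) atTop (𝓝 (l ^ n)) := by
  have hlin : Tendsto (fun ρ : ℝ => l + k * ρ⁻¹) atTop (𝓝 l) := by
    simpa using (tendsto_inv_atTop_zero.const_mul k).const_add l
  refine (hlin.pow n).congr' ?_
  filter_upwards [eventually_gt_atTop 0] with ρ hρ
  rw [← div_pow]
  congr 1
  field_simp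

variable (T U) in
theorem exists_height_shift_pos : ∃ z, 0 < height U (shift T z) := by
  have hK : (0 : ℝ) < (n + 1) * T := mul_pos n.cast_add_one_pos (Nat.cast_pos.2 (NeZero.pos T))
  set K : ℝ := (n + 1) * T
  have hcount : 0 < slabCount T U 0 K (4 * K) (3 * K) := by
    refine pos_of_mul_pos_left (lt_of_lt_of_le ?_ (le_slabCount U 0 K (4 * K) (by linarith)))
      (by positivity)
    exact mul_pos (pow_pos (by linarith) n) (by linarith)
  obtain ⟨z, hz⟩ := Finset.card_pos.1 (Nat.cast_pos.1 hcount)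
  refine ⟨z, hK.trans_le ?_⟩
  simpa using (mem_latticePoints_slab.1 hz).2.1

theorem slabCount_le_slabCount_add_height (U : Space n ≃ₗᵢ[ℝ] Space n) (x : Space n)
    (z : Fin (n + 1) → ℤ) (a b ρ : ℝ) :
    slabCount T U x a b ρ ≤ slabCount T U x (a + height U (shift T z)) (b + height U (shift T z))
      (ρ + 2 * ‖shift T z‖) :=
  (slabCount_le_add U x _ a b ρ).trans_eq (slabCount_add_shift U x z _ _ _)

theorem mul_slabCount_le {z : Fin (n + 1) → ℤ} (hz : 0 ≤ height U (shift T z)) (x : Space n)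
    (a ρ : ℝ) (M : ℕ) :
    M * slabCount T U x a (a + height U (shift T z)) ρ ≤
      slabCount T U x a (a + M * height U (shift T z)) (ρ + 2 * (M * ‖shift T z‖)) := by
  set s := height U (shift T z)
  induction M with
  | zero => simp [slabCount_of_le (T := T) U x le_rfl]
  | succ M ih =>
    have hstep : slabCount T U x a (a + s) ρ ≤
        slabCount T U x (a + M * s) (a + (M + 1) * s) (ρ + 2 * (M * ‖shift T z‖)) := by
      have h := slabCount_le_slabCount_add_height (T := T) U x (M • z) a (a + s) ρ
      rw [shift_nsmul, norm_smul, Real.norm_natCast, map_smul, smul_eq_mul] at h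
      convert h using 2
      ring
    calc ((M + 1 : ℕ) : ℝ) * slabCount T U x a (a + s) ρ
        = M * slabCount T U x a (a + s) ρ + slabCount T U x a (a + s) ρ := by push_cast; ring
      _ ≤ _ := add_le_add ih hstep
      _ = slabCount T U x a (a + (M + 1) * s) (ρ + 2 * (M * ‖shift T z‖)) :=
        slabCount_add_slabCount U x (by nlinarith) (by nlinarith) _
      _ ≤ _ := by
        refine slabCount_mono U x le_rfl (by push_cast; rfl) ?_
        gcongr
        simp

theorem slabCount_le_mul {z : Fin (n + 1) → ℤ} (hz : 0 ≤ height U (shift T z)) (x : Space n)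
    (a ρ : ℝ) (M : ℕ) :
    slabCount T U x a (a + M * height U (shift T z)) ρ ≤
      M * slabCount T U x a (a + height U (shift T z)) (ρ + 2 * (M * ‖shift T z‖)) := by
  set s := height U (shift T z)
  induction M with
  | zero => simp [slabCount_of_le (T := T) U x le_rfl]
  | succ M ih =>
    have hmono : ρ + 2 * (M * ‖shift T z‖) ≤ ρ + 2 * ((M + 1 : ℕ) * ‖shift T z‖) := by
      gcongr
      simp
    have hstep : slabCount T U x (a + M * s) (a + (M + 1) * s) ρ ≤
        slabCount T U x a (a + s) (ρ + 2 * (M * ‖shift T z‖)) := by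
      have h := slabCount_le_slabCount_add_height (T := T) U x (-(M • z)) (a + M * s)
        (a + (M + 1) * s) ρ
      rw [shift_neg, shift_nsmul, norm_neg, norm_smul, Real.norm_natCast, map_neg, map_smul,
        smul_eq_mul] at h
      convert h using 2 <;> ring
    calc slabCount T U x a (a + (M + 1 : ℕ) * s) ρ
        = slabCount T U x a (a + M * s) ρ + slabCount T U x (a + M * s) (a + (M + 1) * s) ρ := by
          rw [slabCount_add_slabCount U x (by nlinarith) (by nlinarith), Nat.cast_succ]
      _ ≤ M * slabCount T U x a (a + s) (ρ + 2 * (M * ‖shift T z‖)) +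
          slabCount T U x a (a + s) (ρ + 2 * (M * ‖shift T z‖)) := add_le_add ih hstep
      _ = (M + 1 : ℕ) * slabCount T U x a (a + s) (ρ + 2 * (M * ‖shift T z‖)) := by
          push_cast; ring
      _ ≤ _ := by
        gcongr
        exact slabCount_mono U x le_rfl le_rfl hmono

theorem eventually_slabCount_div_lt (hs : s ∈ heightGroup T U) (hs0 : 0 ≤ s)
    (hl : s / T ^ (n + 1) < l) (x : Space n) (a : ℝ) :
    ∀ᶠ ρ in atTop, slabCount T U x a (a + s) ρ / ρ ^ n < l := by
  obtain ⟨z, rfl : height U (shift T z) = s⟩ := hs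
  set s := height U (shift T z)
  set K : ℝ := (n + 1) * T
  have hD : (0 : ℝ) < T ^ (n + 1) := pow_pos (Nat.cast_pos.2 (NeZero.pos T)) _
  have hM : Tendsto (fun M : ℕ => (s + 2 * K / M) / T ^ (n + 1)) atTop (𝓝 (s / T ^ (n + 1))) := by
    simpa using ((tendsto_const_div_atTop_nhds_zero_nat (2 * K)).const_add s).div_const _
  obtain ⟨M, hMl, hM0⟩ := ((hM.eventually_lt_const hl).and (eventually_gt_atTop 0)).exists
  have hM0 : (0 : ℝ) < M := Nat.cast_pos.2 hM0
  have hlim := (tendsto_affine_pow_div_pow 1 (2 * (M * ‖shift T z‖) + 2 * K) n).mul_const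
    ((s + 2 * K / M) / T ^ (n + 1))
  rw [one_pow, one_mul] at hlim
  filter_upwards [hlim.eventually_lt_const hMl, eventually_gt_atTop 0] with ρ hρl hρ
  refine lt_of_le_of_lt ?_ hρl
  have hcount := (mul_le_mul_of_nonneg_right (mul_slabCount_le hs0 x a ρ M) hD.le).trans
    (slabCount_le U x (by nlinarith) (by positivity))
  rw [div_mul_eq_mul_div]
  refine div_le_div_of_nonneg_right ?_ (by positivity)
  rw [mul_div_assoc', le_div_iff₀ hD]
  refine le_of_mul_le_mul_left ?_ hM0
  calc M * (slabCount T U x a (a + s) ρ * T ^ (n + 1)) = _ := by rw [mul_assoc]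
    _ ≤ _ := hcount
    _ = _ := by field_simp; ring

theorem eventually_lt_slabCount_div (hs : s ∈ heightGroup T U) (hs0 : 0 ≤ s)
    (hl : l < s / T ^ (n + 1)) (x : Space n) (a : ℝ) :
    ∀ᶠ ρ in atTop, l < slabCount T U x a (a + s) ρ / ρ ^ n := by
  obtain ⟨z, rfl : height U (shift T z) = s⟩ := hs
  set s := height U (shift T z)
  set K : ℝ := (n + 1) * T
  have hD : (0 : ℝ) < T ^ (n + 1) := pow_pos (Nat.cast_pos.2 (NeZero.pos T)) _
  have hM : Tendsto (fun M : ℕ => (s - 2 * K / M) / T ^ (n + 1)) atTop (𝓝 (s / T ^ (n + 1))) := by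
    simpa using ((tendsto_const_div_atTop_nhds_zero_nat (2 * K)).const_sub s).div_const _
  obtain ⟨M, hMl, hM0⟩ := ((hM.eventually_const_lt hl).and (eventually_gt_atTop 0)).exists
  have hM0 : (0 : ℝ) < M := Nat.cast_pos.2 hM0
  set k : ℝ := 2 * (M * ‖shift T z‖)
  have hlim := (tendsto_affine_pow_div_pow 1 (-k - 2 * K) n).mul_const
    ((s - 2 * K / M) / T ^ (n + 1))
  rw [one_pow, one_mul] at hlim
  filter_upwards [hlim.eventually_const_lt hMl, eventually_gt_atTop 0,
    eventually_ge_atTop (k + 2 * K)] with ρ hρl hρ hρk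
  refine hρl.trans_le ?_
  have hcount := (le_slabCount U x a (a + M * s) (by linarith : 2 * K ≤ ρ - k)).trans
    (mul_le_mul_of_nonneg_right (slabCount_le_mul hs0 x a (ρ - k) M) hD.le)
  rw [sub_add_cancel] at hcount
  rw [div_mul_eq_mul_div]
  refine div_le_div_of_nonneg_right ?_ (by positivity)
  rw [mul_div_assoc', div_le_iff₀ hD]
  refine le_of_mul_le_mul_left ?_ hM0
  calc _ = (ρ - k - 2 * K) ^ n * (a + M * s - a - 2 * K) := by field_simp; ring
    _ ≤ _ := hcount
    _ = _ := by ring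

theorem tendsto_slabCount_of_mem_heightGroup (hs : s ∈ heightGroup T U) (hs0 : 0 ≤ s)
    (x : Space n) (a : ℝ) :
    Tendsto (fun ρ => slabCount T U x a (a + s) ρ / ρ ^ n) atTop (𝓝 (s / T ^ (n + 1))) :=
  tendsto_order.2 ⟨fun _ hl => eventually_lt_slabCount_div hs hs0 hl x a,
    fun _ hl => eventually_slabCount_div_lt hs hs0 hl x a⟩

theorem tendsto_slabCount_of_dense (hH : Dense (heightGroup T U : Set ℝ)) (hab : a < b)
    (x : Space n) :
    Tendsto (fun ρ => slabCount T U x a b ρ / ρ ^ n) atTop (𝓝 ((b - a) / T ^ (n + 1))) := by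
  have hD : (0 : ℝ) < T ^ (n + 1) := pow_pos (Nat.cast_pos.2 (NeZero.pos T)) _
  refine tendsto_order.2 ⟨fun l hl => ?_, fun l hl => ?_⟩
  · obtain ⟨s, hs, hls, hsb⟩ := hH.exists_between
      (max_lt ((lt_div_iff₀ hD).1 hl) (sub_pos.2 hab))
    obtain ⟨hls, hs0⟩ := max_lt_iff.1 hls
    filter_upwards [eventually_lt_slabCount_div hs hs0.le ((lt_div_iff₀ hD).2 hls) x a,
      eventually_gt_atTop 0] with ρ hρ hρ0
    refine hρ.trans_le ?_
    gcongr
    exact slabCount_mono U x le_rfl (by linarith) le_rfl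
  · obtain ⟨s, hs, hbs, hsl⟩ := hH.exists_between ((div_lt_iff₀ hD).1 hl)
    filter_upwards [eventually_slabCount_div_lt hs (by linarith) ((div_lt_iff₀ hD).2 hsl) x a,
      eventually_gt_atTop 0] with ρ hρ hρ0
    refine lt_of_le_of_lt ?_ hρ
    gcongr
    exact slabCount_mono U x le_rfl (by linarith) le_rfl

theorem le_height_iff_of_eq_zmultiples {T : ℕ} {g : ℝ} (hg : 0 < g)
    (hH : heightGroup T U = AddSubgroup.zmultiples g) (x : Space n) (a : ℝ)
    (z : Fin (n + 1) → ℤ) :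
    height U x + ⌈(a - height U x) / g⌉ * g ≤ height U (x + shift T z) ↔
      a ≤ height U (x + shift T z) := by
  obtain ⟨k, hk⟩ := AddSubgroup.mem_zmultiples_iff.1
    (hH ▸ height_shift_mem_heightGroup T U z)
  rw [map_add, ← hk, zsmul_eq_mul, add_le_add_iff_left, mul_le_mul_iff_left₀ hg, Int.cast_le,
    Int.ceil_le, div_le_iff₀ hg, sub_le_iff_le_add']

theorem exists_tendsto_slabCount_of_eq_zmultiples {g : ℝ} (hg : 0 < g)
    (hH : heightGroup T U = AddSubgroup.zmultiples g) (hab : a ≤ b) (x : Space n) :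
    ∃ l, Tendsto (fun ρ => slabCount T U x a b ρ / ρ ^ n) atTop (𝓝 l) := by
  set m : ℝ → ℤ := fun t => ⌈(t - height U x) / g⌉
  have hm : m a ≤ m b := Int.ceil_mono (by gcongr)
  have hslab : ∀ ρ, slabCount T U x a b ρ = slabCount T U x (height U x + m a * g)
      (height U x + m a * g + (m b - m a) • g) ρ := fun ρ => by
    refine congrArg (fun Z : Finset (Fin (n + 1) → ℤ) => (Z.card : ℝ)) (Finset.ext fun z => ?_)
    rw [mem_latticePoints_slab, mem_latticePoints_slab, zsmul_eq_mul, Int.cast_sub, sub_mul,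
      add_assoc, add_sub_cancel]
    exact and_congr_right fun _ => and_congr (le_height_iff_of_eq_zmultiples hg hH x a z).symm
      (lt_iff_lt_of_le_iff_le (le_height_iff_of_eq_zmultiples hg hH x b z).symm)
  simp only [hslab]
  exact ⟨_, tendsto_slabCount_of_mem_heightGroup (hH ▸ AddSubgroup.zsmul_mem_zmultiples g _)
    (zsmul_nonneg hg.le (sub_nonneg.2 hm)) x _⟩

variable (T U x a b) in
theorem exists_tendsto_slabCount :
    ∃ l, Tendsto (fun ρ => slabCount T U x a b ρ / ρ ^ n) atTop (𝓝 l) := by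
  rcases le_or_gt b a with hba | hab
  · exact ⟨0, by simp [slabCount_of_le U x hba]⟩
  rcases (heightGroup T U).dense_or_cyclic with hdense | ⟨g, hg⟩
  · exact ⟨_, tendsto_slabCount_of_dense hdense hab x⟩
  have hg0 : g ≠ 0 := by
    rintro rfl
    obtain ⟨z, hz⟩ := exists_height_shift_pos T U
    have hmem := hg ▸ height_shift_mem_heightGroup T U z
    simp only [AddSubgroup.closure_singleton_zero, AddSubgroup.mem_bot] at hmem
    exact hz.ne' hmem
  refine exists_tendsto_slabCount_of_eq_zmultiples (abs_pos.2 hg0) ?_ hab.le x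
  rw [hg, ← AddSubgroup.zmultiples_eq_closure]
  rcases abs_choice g with h | h <;> simp [h]

/-- The number of points of `x + T ℤ^d` per unit area of the slab with heights in `[a, b)`. -/
def slabDensity (T : ℕ) (U : Space n ≃ₗᵢ[ℝ] Space n) (x : Space n) (a b : ℝ) : ℝ :=
  limUnder atTop fun ρ => slabCount T U x a b ρ / ρ ^ n

variable (T U x a b) in
theorem tendsto_slabCount :
    Tendsto (fun ρ => slabCount T U x a b ρ / ρ ^ n) atTop (𝓝 (slabDensity T U x a b)) :=
  tendsto_nhds_limUnder (exists_tendsto_slabCount T U x a b)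

variable (T U x a b) in
theorem tendsto_slabCount_affine (hl : 0 < l) (k : ℝ) :
    Tendsto (fun ρ => slabCount T U x a b (l * ρ + k) / ρ ^ n) atTop
      (𝓝 (l ^ n * slabDensity T U x a b)) := by
  have hlin : Tendsto (fun ρ : ℝ => l * ρ + k) atTop atTop :=
    tendsto_atTop_add_const_right _ _ (tendsto_id.const_mul_atTop hl)
  refine ((tendsto_affine_pow_div_pow l k n).mul
    ((tendsto_slabCount T U x a b).comp hlin)).congr' ?_
  filter_upwards [hlin.eventually_gt_atTop 0] with ρ hρ
  have : (l * ρ + k) ^ n ≠ 0 := by positivity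
  simp only [Function.comp]
  field_simp

variable (T U x) in
theorem slabDensity_nonneg (a b : ℝ) : 0 ≤ slabDensity T U x a b := by
  refine ge_of_tendsto (tendsto_slabCount T U x a b) ?_
  filter_upwards [eventually_ge_atTop 0] with ρ hρ
  exact div_nonneg (slabCount_nonneg T U x a b ρ) (pow_nonneg hρ n)

theorem slabDensity_of_le (hba : b ≤ a) : slabDensity T U x a b = 0 :=
  tendsto_nhds_unique (tendsto_slabCount T U x a b) (by simp [slabCount_of_le U x hba])

theorem slabDensity_add_slabDensity (hab : a ≤ b) (hbc : b ≤ c) :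
    slabDensity T U x a b + slabDensity T U x b c = slabDensity T U x a c := by
  refine tendsto_nhds_unique
    ((tendsto_slabCount T U x a b).add (tendsto_slabCount T U x b c)) ?_
  simpa only [← add_div, slabCount_add_slabCount U x hab hbc] using tendsto_slabCount T U x a c

theorem slabDensity_of_mem_heightGroup (hs : s ∈ heightGroup T U) (hs0 : 0 ≤ s) (x : Space n)
    (a : ℝ) : slabDensity T U x a (a + s) = s / T ^ (n + 1) :=
  tendsto_nhds_unique (tendsto_slabCount T U x a _)
    (tendsto_slabCount_of_mem_heightGroup hs hs0 x a)

variable (T U) in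
theorem slabDensity_le_add (x v : Space n) (a b : ℝ) :
    slabDensity T U x a b ≤ slabDensity T U (x + v) (a + height U v) (b + height U v) := by
  have hlim := tendsto_slabCount_affine T U (x + v) (a + height U v) (b + height U v) one_pos
    (2 * ‖v‖)
  rw [one_pow, one_mul] at hlim
  refine le_of_tendsto_of_tendsto (tendsto_slabCount T U x a b) hlim ?_
  filter_upwards [eventually_ge_atTop 0] with ρ hρ
  rw [one_mul]
  gcongr
  exact slabCount_le_add U x v a b ρ

variable (T U) in
theorem slabDensity_add (x v : Space n) (a b : ℝ) :
    slabDensity T U (x + v) (a + height U v) (b + height U v) = slabDensity T U x a b := by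
  refine le_antisymm ?_ (slabDensity_le_add T U x v a b)
  simpa using slabDensity_le_add T U (x + v) (-v) (a + height U v) (b + height U v)

/-- The signed density of the points of `T ℤ^d` with heights between `0` and `h`. -/
def cumulativeDensity (T : ℕ) (U : Space n ≃ₗᵢ[ℝ] Space n) (h : ℝ) : ℝ :=
  slabDensity T U 0 0 h - slabDensity T U 0 h 0

theorem slabDensity_zero_eq (hab : a ≤ b) :
    slabDensity T U 0 a b = cumulativeDensity T U b - cumulativeDensity T U a := by
  rw [cumulativeDensity, cumulativeDensity]
  rcases le_total 0 a with ha | ha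
  · rw [slabDensity_of_le (ha.trans hab), slabDensity_of_le ha,
      ← slabDensity_add_slabDensity ha hab]
    ring
  rcases le_total 0 b with hb | hb
  · rw [slabDensity_of_le hb, slabDensity_of_le ha, ← slabDensity_add_slabDensity ha hb]
    ring
  · rw [slabDensity_of_le hb, slabDensity_of_le ha, ← slabDensity_add_slabDensity hab hb]
    ring

variable (T U) in
theorem monotone_cumulativeDensity :
    Monotone (cumulativeDensity T U) := fun a b hab => by
  rw [← sub_nonneg, ← slabDensity_zero_eq hab]
  exact slabDensity_nonneg T U 0 a b

variable (T U) in
theorem slabDensity_eq_max (x : Space n) (a b : ℝ) :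
    slabDensity T U x a b =
      max (cumulativeDensity T U (b - height U x) - cumulativeDensity T U (a - height U x)) 0 := by
  rcases le_total a b with hab | hba
  · have h0 := slabDensity_add T U x (-x) a b
    rw [add_neg_cancel, map_neg, ← sub_eq_add_neg, ← sub_eq_add_neg,
      slabDensity_zero_eq (by gcongr)] at h0
    rw [h0, max_eq_left (slabDensity_nonneg T U x a b)]
  · rw [slabDensity_of_le hba, max_eq_right]
    exact sub_nonpos.2 (monotone_cumulativeDensity T U (by gcongr))

theorem cumulativeDensity_add (hs : s ∈ heightGroup T U) (h : ℝ) :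
    cumulativeDensity T U (h + s) = cumulativeDensity T U h + s / T ^ (n + 1) := by
  have hnonneg : ∀ s ∈ heightGroup T U, 0 ≤ s → ∀ h,
      cumulativeDensity T U (h + s) = cumulativeDensity T U h + s / T ^ (n + 1) :=
    fun s hs hs0 h => by
      rw [← slabDensity_of_mem_heightGroup hs hs0 0 h, slabDensity_zero_eq (by linarith)]
      ring
  rcases le_total 0 s with hs0 | hs0
  · exact hnonneg s hs hs0 h
  · have h1 := hnonneg (-s) (neg_mem hs) (neg_nonneg.2 hs0) (h + s)
    rw [add_neg_cancel_right, neg_div] at h1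
    linarith

end Density

/-! ### Energies on periodic graphs -/

/-- A `T ℤ^d`-periodic weighted directed graph in `ℝ^d`, described by its quotient: the nodes are
`pos p + T z`, and each `e : E` stands for the edges from `pos (src e) + T z` to
`pos (tgt e) + T (z + off e)` with capacity `cap e`. -/
structure PeriodicGraph (n : ℕ) (P E : Type*) where
  pos : P → Space n
  src : E → P
  tgt : E → P
  off : E → Fin (n + 1) → ℤ
  cap : E → ℝ
  cap_nonneg : ∀ e, 0 ≤ cap e

namespace PeriodicGraph

variable {P E : Type*}

section Basic

variable (G : PeriodicGraph n P E)

/-- The position of a node. -/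
def loc (T : ℕ) (p : P) (z : Fin (n + 1) → ℤ) : Space n := G.pos p + shift T z

/-- The decrease of a function along an edge. -/
def diff (u : P → (Fin (n + 1) → ℤ) → ℝ) (e : E) (z : Fin (n + 1) → ℤ) : ℝ :=
  u (G.src e) z - u (G.tgt e) (z + G.off e)

/-- The vector from the end point of an edge to its starting point. -/
def disp (T : ℕ) (e : E) : Space n := G.pos (G.src e) - G.pos (G.tgt e) - shift T (G.off e)

/-- The energy of the edges that start in `A`. -/
def graphEnergy [Fintype E] (T : ℕ) (u : P → (Fin (n + 1) → ℤ) → ℝ) (A : Set (Space n)) : ℝ :=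
  ∑ e, G.cap e * ∑ z ∈ latticePoints T A (G.pos (G.src e)), max (G.diff u e z) 0

open Classical in
/-- The indicator of the nodes whose height plus `ψ` is nonnegative; for `ψ = 0` this is the
indicator of a half-space. -/
def level (T : ℕ) (U : Space n ≃ₗᵢ[ℝ] Space n) (ψ : P → ℝ) (p : P) (z : Fin (n + 1) → ℤ) : ℝ :=
  if 0 ≤ height U (G.loc T p z) + ψ p then 1 else 0

/-- A circulation: a function on the edges without divergence in the quotient graph, expressed by
duality with the functions on the nodes. -/
def IsCirculation [Fintype E] (β : E → ℝ) : Prop :=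
  ∀ q : P → ℝ, ∑ e, β e * (q (G.src e) - q (G.tgt e)) = 0

variable {G} {U : Space n ≃ₗᵢ[ℝ] Space n} {R C ρ S : ℝ} {e : E} {z : Fin (n + 1) → ℤ}

theorem loc_tgt (T : ℕ) (e : E) (z : Fin (n + 1) → ℤ) :
    G.loc T (G.tgt e) (z + G.off e) = G.loc T (G.src e) z - G.disp T e := by
  rw [loc, loc, disp, shift_add]
  abel

theorem height_loc_tgt (T : ℕ) (e : E) (z : Fin (n + 1) → ℤ) :
    height U (G.loc T (G.tgt e) (z + G.off e)) =
      height U (G.loc T (G.src e) z) - height U (G.disp T e) := by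
  rw [loc_tgt, map_sub]

theorem loc_tgt_mem (hR : ‖G.disp T e‖ ≤ R) (h : G.loc T (G.src e) z ∈ rotatedCube U ρ) :
    G.loc T (G.tgt e) (z + G.off e) ∈ rotatedCube U (ρ + 2 * R) := by
  rw [loc_tgt, sub_eq_add_neg]
  exact add_mem_rotatedCube h (by rwa [norm_neg])

theorem loc_src_mem (hR : ‖G.disp T e‖ ≤ R)
    (h : G.loc T (G.tgt e) (z + G.off e) ∈ rotatedCube U ρ) :
    G.loc T (G.src e) z ∈ rotatedCube U (ρ + 2 * R) := by
  rw [← sub_add_cancel (G.loc T (G.src e) z) (G.disp T e), ← loc_tgt]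
  exact add_mem_rotatedCube h hR

theorem diff_level (T : ℕ) (ψ : P → ℝ) (e : E) (z : Fin (n + 1) → ℤ) :
    G.diff (G.level T U ψ) e z =
      (Set.Ico (-ψ (G.src e)) (height U (G.disp T e) - ψ (G.tgt e))).indicator 1
        (height U (G.loc T (G.src e) z)) -
      (Set.Ico (height U (G.disp T e) - ψ (G.tgt e)) (-ψ (G.src e))).indicator 1
        (height U (G.loc T (G.src e) z)) := by
  simp only [diff, level, height_loc_tgt, Set.indicator, Set.mem_Ico, Pi.one_apply]
  split_ifs <;> grind

theorem max_diff_level (T : ℕ) (ψ : P → ℝ) (e : E) (z : Fin (n + 1) → ℤ) :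
    max (G.diff (G.level T U ψ) e z) 0 =
      (Set.Ico (-ψ (G.src e)) (height U (G.disp T e) - ψ (G.tgt e))).indicator 1
        (height U (G.loc T (G.src e) z)) := by
  rw [diff_level]
  simp only [Set.indicator, Set.mem_Ico, Pi.one_apply]
  split_ifs <;> grind

theorem level_eq_one {ψ : P → ℝ} {p : P} (hψ : |ψ p| ≤ C) (h : C ≤ height U (G.loc T p z)) :
    G.level T U ψ p z = 1 :=
  if_pos (by linarith [neg_le_of_abs_le hψ])

theorem level_eq_zero {ψ : P → ℝ} {p : P} (hψ : |ψ p| ≤ C) (h : height U (G.loc T p z) < -C) :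
    G.level T U ψ p z = 0 :=
  if_neg (by linarith [le_of_abs_le hψ])

theorem level_eq_zero_or_one (ψ : P → ℝ) (p : P) (z : Fin (n + 1) → ℤ) :
    G.level T U ψ p z = 0 ∨ G.level T U ψ p z = 1 :=
  (ite_eq_or_eq _ _ _).symm

variable [NeZero T]

variable [Fintype E]

theorem graphEnergy_sub_eq (hR : ∀ e, ‖G.disp T e‖ ≤ R) {ρ' : ℝ} (hR0 : 0 ≤ R)
    (hρ : ρ + 2 * R ≤ ρ') (hS : ρ' ≤ S) {u v : P → (Fin (n + 1) → ℤ) → ℝ}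
    (huv : ∀ p z, G.loc T p z ∉ rotatedCube U ρ → u p z = v p z) :
    G.graphEnergy T u (rotatedCube U S) - G.graphEnergy T u (rotatedCube U ρ') =
      G.graphEnergy T v (rotatedCube U S) - G.graphEnergy T v (rotatedCube U ρ') := by
  classical
  simp only [graphEnergy, ← Finset.sum_sub_distrib, ← mul_sub]
  refine Finset.sum_congr rfl fun e _ => congrArg _ ?_
  have hsub := latticePoints_mono (T := T) (rotatedCube_mono (U := U) hS)
    (isBounded_rotatedCube U S) (G.pos (G.src e))
  rw [← Finset.sum_sdiff_eq_sub hsub, ← Finset.sum_sdiff_eq_sub hsub]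
  refine Finset.sum_congr rfl fun z hz => ?_
  have hz' : G.loc T (G.src e) z ∉ rotatedCube U ρ' := fun h =>
    (Finset.mem_sdiff.1 hz).2 (mem_latticePoints_rotatedCube.2 h)
  have hsrc : G.loc T (G.src e) z ∉ rotatedCube U ρ := fun h =>
    hz' (rotatedCube_mono (by linarith) h)
  have htgt : G.loc T (G.tgt e) (z + G.off e) ∉ rotatedCube U ρ := fun h =>
    hz' (rotatedCube_mono hρ (loc_src_mem (hR e) h))
  rw [diff, diff, huv _ _ hsrc, huv _ _ htgt]

theorem graphEnergy_level_zero (hR : ∀ e, ‖G.disp T e‖ ≤ R) (hS : 2 * R ≤ S) (hS0 : 0 ≤ S) :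
    G.graphEnergy T (G.level T U 0) (rotatedCube U S) =
      ∑ e, G.cap e * slabCount T U (G.pos (G.src e)) 0 (height U (G.disp T e)) S := by
  refine Finset.sum_congr rfl fun e _ => congrArg _ ?_
  have hd := le_of_abs_le ((abs_height_le U (G.disp T e)).trans (hR e))
  rw [slabCount_eq_sum_height (by linarith) (by linarith)]
  simp only [max_diff_level, Pi.zero_apply, neg_zero, sub_zero]
  rfl

end Basic

end PeriodicGraph

/-! ### The energy of competitors -/

namespace PeriodicGraph

section Bounds

variable {P E : Type*} {G : PeriodicGraph n P E} {U : Space n ≃ₗᵢ[ℝ] Space n} {R C ρ ρ' S : ℝ}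
  {ψ : P → ℝ} {u v : P → (Fin (n + 1) → ℤ) → ℝ} {β : E → ℝ}

open Classical in
/-- The competitor that is a level function in the cube of side `ρ` and the half-space outside. -/
def glued (G : PeriodicGraph n P E) (T : ℕ) (U : Space n ≃ₗᵢ[ℝ] Space n) (ψ : P → ℝ) (ρ : ℝ)
    (p : P) (z : Fin (n + 1) → ℤ) : ℝ :=
  if G.loc T p z ∈ rotatedCube U ρ then G.level T U ψ p z else G.level T U 0 p z

theorem glued_eq_one {p : P} {z : Fin (n + 1) → ℤ} (hψ : |ψ p| ≤ C)
    (h : C ≤ height U (G.loc T p z)) : G.glued T U ψ ρ p z = 1 := by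
  have h0 : |(0 : P → ℝ) p| ≤ C := by simpa using (abs_nonneg _).trans hψ
  rw [glued, level_eq_one hψ h, level_eq_one h0 h, ite_self]

theorem glued_eq_zero {p : P} {z : Fin (n + 1) → ℤ} (hψ : |ψ p| ≤ C)
    (h : height U (G.loc T p z) < -C) : G.glued T U ψ ρ p z = 0 := by
  have h0 : |(0 : P → ℝ) p| ≤ C := by simpa using (abs_nonneg _).trans hψ
  rw [glued, level_eq_zero hψ h, level_eq_zero h0 h, ite_self]

theorem glued_eq_zero_or_one (ψ : P → ℝ) (ρ : ℝ) (p : P) (z : Fin (n + 1) → ℤ) :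
    G.glued T U ψ ρ p z = 0 ∨ G.glued T U ψ ρ p z = 1 := by
  rw [glued]
  split_ifs
  exacts [level_eq_zero_or_one ψ p z, level_eq_zero_or_one 0 p z]

theorem diff_glued_eq_zero {e : E} {z : Fin (n + 1) → ℤ} (hR : ‖G.disp T e‖ ≤ R)
    (hψ : ∀ p, |ψ p| + R ≤ C) (hz : height U (G.loc T (G.src e) z) ∉ Set.Ico (-C) C) :
    G.diff (G.glued T U ψ ρ) e z = 0 := by
  have hd := abs_le.1 ((abs_height_le U (G.disp T e)).trans hR)
  have hψ' : ∀ p, |ψ p| ≤ C - R := fun p => le_sub_iff_add_le.2 (hψ p)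
  have htgt := height_loc_tgt (G := G) (U := U) T e z
  rw [diff, sub_eq_zero]
  rcases le_or_gt (-C) (height U (G.loc T (G.src e) z)) with h | h
  · rw [Set.mem_Ico, not_and, not_lt] at hz
    rw [glued_eq_one (hψ' _) (by linarith [hz h]), glued_eq_one (hψ' _) (by linarith [hz h])]
  · rw [glued_eq_zero (hψ' _) (by linarith), glued_eq_zero (hψ' _) (by linarith)]

theorem max_diff_glued_of_mem {e : E} {z : Fin (n + 1) → ℤ} (hR : ‖G.disp T e‖ ≤ R)
    (hψ : ∀ p, |ψ p| + R ≤ C) (hC : 2 * C ≤ ρ)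
    (hz : G.loc T (G.src e) z ∈ rotatedCube U (ρ - 2 * R)) :
    max (G.diff (G.glued T U ψ ρ) e z) 0 =
      (slab U (-ψ (G.src e)) (height U (G.disp T e) - ψ (G.tgt e)) ρ).indicator 1
        (G.loc T (G.src e) z) := by
  have hR0 : 0 ≤ R := (norm_nonneg _).trans hR
  have hd := abs_le.1 ((abs_height_le U (G.disp T e)).trans hR)
  have hs := abs_le.1 (le_sub_iff_add_le.2 (hψ (G.src e)))
  have ht := abs_le.1 (le_sub_iff_add_le.2 (hψ (G.tgt e)))
  have hsrc : G.loc T (G.src e) z ∈ rotatedCube U ρ := rotatedCube_mono (by linarith) hz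
  have htgt := loc_tgt_mem hR hz
  rw [sub_add_cancel] at htgt
  have hdiff : G.diff (G.glued T U ψ ρ) e z = G.diff (G.level T U ψ) e z := by
    rw [diff, diff, glued, glued, if_pos hsrc, if_pos htgt]
  rw [hdiff, max_diff_level]
  simp only [Set.indicator, Set.mem_Ico, mem_slab_iff_mem_rotatedCube (U := U) (ρ := ρ)
    (a := -ψ (G.src e)) (b := height U (G.disp T e) - ψ (G.tgt e)) (by linarith) (by linarith),
    hsrc, true_and, Pi.one_apply]

/-- Deep inside the cube an edge sees only the level function; near the boundary of the cube it
can only be crossed at heights of order `C`. -/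
theorem max_diff_glued_le {e : E} {z : Fin (n + 1) → ℤ} (hR : ‖G.disp T e‖ ≤ R)
    (hψ : ∀ p, |ψ p| + R ≤ C) (hC : 2 * C ≤ ρ - 2 * R)
    (hz : G.loc T (G.src e) z ∈ rotatedCube U (ρ + 2 * R)) :
    max (G.diff (G.glued T U ψ ρ) e z) 0 ≤
      (slab U (-ψ (G.src e)) (height U (G.disp T e) - ψ (G.tgt e)) ρ).indicator 1
          (G.loc T (G.src e) z) +
        ((slab U (-C) C (ρ + 2 * R)).indicator 1 (G.loc T (G.src e) z) -
          (slab U (-C) C (ρ - 2 * R)).indicator 1 (G.loc T (G.src e) z)) := by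
  have hR0 : 0 ≤ R := (norm_nonneg _).trans hR
  set X := G.loc T (G.src e) z
  have hmono : (slab U (-C) C (ρ - 2 * R)).indicator (1 : Space n → ℝ) X ≤
      (slab U (-C) C (ρ + 2 * R)).indicator 1 X :=
    Set.indicator_le_indicator_of_subset (slab_mono le_rfl le_rfl (by linarith))
      (fun _ => zero_le_one) X
  have hnonneg : 0 ≤ (slab U (-ψ (G.src e)) (height U (G.disp T e) - ψ (G.tgt e)) ρ).indicator
      (1 : Space n → ℝ) X := Set.indicator_nonneg (fun _ _ => zero_le_one) X
  by_cases hdeep : X ∈ rotatedCube U (ρ - 2 * R)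
  · rw [max_diff_glued_of_mem hR hψ (by linarith) hdeep]
    linarith
  by_cases hh : height U X ∈ Set.Ico (-C) C
  · have hsmall : X ∉ slab U (-C) C (ρ - 2 * R) := fun h =>
      hdeep ((mem_slab_iff_mem_rotatedCube (by linarith) (by linarith)).1 h).1
    have hbig : X ∈ slab U (-C) C (ρ + 2 * R) :=
      (mem_slab_iff_mem_rotatedCube (by linarith) (by linarith)).2 ⟨hz, hh⟩
    have hdiff : max (G.diff (G.glued T U ψ ρ) e z) 0 ≤ 1 := by
      rw [diff]
      rcases glued_eq_zero_or_one (G := G) (T := T) (U := U) ψ ρ (G.src e) z with h | h <;>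
      rcases glued_eq_zero_or_one (G := G) (T := T) (U := U) ψ ρ (G.tgt e) (z + G.off e)
        with h' | h' <;> simp [h, h']
    rw [Set.indicator_of_mem hbig, Set.indicator_of_notMem hsmall, Pi.one_apply]
    linarith
  · rw [diff_glued_eq_zero hR hψ hh, max_self]
    linarith

section Counts

variable [NeZero T]

theorem sum_diff_level_zero {e : E} (hR : ‖G.disp T e‖ ≤ R) (hR0 : 0 ≤ R) (hρ : 2 * R ≤ ρ) :
    ∑ z ∈ latticePoints T (rotatedCube U ρ) (G.pos (G.src e)), G.diff (G.level T U 0) e z =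
      slabCount T U (G.pos (G.src e)) 0 (height U (G.disp T e)) ρ -
        slabCount T U (G.pos (G.src e)) (height U (G.disp T e)) 0 ρ := by
  have hd := abs_le.1 ((abs_height_le U (G.disp T e)).trans hR)
  rw [slabCount_eq_sum_height (by linarith) (by linarith),
    slabCount_eq_sum_height (by linarith) (by linarith), ← Finset.sum_sub_distrib]
  simp only [diff_level, Pi.zero_apply, neg_zero, sub_zero]
  rfl

theorem sum_max_diff_glued_le {e : E} (hR : ‖G.disp T e‖ ≤ R) (hψ : ∀ p, |ψ p| + R ≤ C)
    (hC : 2 * C ≤ ρ - 2 * R) :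
    ∑ z ∈ latticePoints T (rotatedCube U (ρ + 2 * R)) (G.pos (G.src e)),
        max (G.diff (G.glued T U ψ ρ) e z) 0 ≤
      slabCount T U (G.pos (G.src e)) (-ψ (G.src e)) (height U (G.disp T e) - ψ (G.tgt e)) ρ +
        (slabCount T U (G.pos (G.src e)) (-C) C (ρ + 2 * R) -
          slabCount T U (G.pos (G.src e)) (-C) C (ρ - 2 * R)) := by
  have hR0 : 0 ≤ R := (norm_nonneg _).trans hR
  have hd := abs_le.1 ((abs_height_le U (G.disp T e)).trans hR)
  have hs := abs_le.1 (le_sub_iff_add_le.2 (hψ (G.src e)))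
  have ht := abs_le.1 (le_sub_iff_add_le.2 (hψ (G.tgt e)))
  have hcount : ∀ {a b σ : ℝ}, -C ≤ a → b ≤ C → σ ≤ ρ + 2 * R →
      slabCount T U (G.pos (G.src e)) a b σ =
        ∑ z ∈ latticePoints T (rotatedCube U (ρ + 2 * R)) (G.pos (G.src e)),
          (slab U a b σ).indicator 1 (G.loc T (G.src e) z) := fun ha hb hσ =>
    slabCount_eq_sum (isBounded_rotatedCube U _) (by
      rw [rotatedCube_eq_slab]
      exact slab_mono (by linarith) (by linarith) hσ) _
  rw [hcount (by linarith) (by linarith) (by linarith), hcount le_rfl le_rfl le_rfl,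
    hcount le_rfl le_rfl (by linarith), ← Finset.sum_sub_distrib, ← Finset.sum_add_distrib]
  exact Finset.sum_le_sum fun z hz =>
    max_diff_glued_le hR hψ hC (mem_latticePoints_rotatedCube.1 hz)

end Counts

variable [Fintype E]

theorem IsCirculation.sum_tsum_diff (hβ : G.IsCirculation β)
    (hu : ∀ p, (Function.support (u p)).Finite) : ∑ e, β e * ∑' z, G.diff u e z = 0 := by
  rw [← hβ fun p => ∑' z, u p z]
  refine Finset.sum_congr rfl fun e _ => congrArg _ ?_
  have hsummable : ∀ p, Summable (u p) := fun p => summable_of_hasFiniteSupport (hu p)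
  have hshift := (Equiv.addRight (G.off e)).summable_iff.2 (hsummable (G.tgt e))
  exact ((hsummable (G.src e)).tsum_sub hshift).trans <| congrArg _ <|
    (Equiv.addRight (G.off e)).tsum_eq (u (G.tgt e))

theorem sum_mul_diff_le_graphEnergy (hβ0 : ∀ e, 0 ≤ β e) (hβc : ∀ e, β e ≤ G.cap e)
    (u : P → (Fin (n + 1) → ℤ) → ℝ) (A : Set (Space n)) :
    ∑ e, β e * ∑ z ∈ latticePoints T A (G.pos (G.src e)), G.diff u e z ≤ G.graphEnergy T u A := by
  refine Finset.sum_le_sum fun e _ => ?_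
  have hmax : ∑ z ∈ latticePoints T A (G.pos (G.src e)), G.diff u e z ≤
      ∑ z ∈ latticePoints T A (G.pos (G.src e)), max (G.diff u e z) 0 :=
    Finset.sum_le_sum fun z _ => le_max_left _ _
  exact (mul_le_mul_of_nonneg_left hmax (hβ0 e)).trans <|
    mul_le_mul_of_nonneg_right (hβc e) (Finset.sum_nonneg fun z _ => le_max_right _ _)

variable [NeZero T]

theorem IsCirculation.sum_diff_eq (hβ : G.IsCirculation β) (hR : ∀ e, ‖G.disp T e‖ ≤ R)
    (hR0 : 0 ≤ R) (hρ : ρ + 2 * R ≤ ρ')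
    (huv : ∀ p z, G.loc T p z ∉ rotatedCube U ρ → u p z = v p z) :
    ∑ e, β e * ∑ z ∈ latticePoints T (rotatedCube U ρ') (G.pos (G.src e)), G.diff u e z =
      ∑ e, β e * ∑ z ∈ latticePoints T (rotatedCube U ρ') (G.pos (G.src e)), G.diff v e z := by
  have hsupport : ∀ p, (Function.support ((u - v) p)).Finite := fun p =>
    (finite_setOf_add_shift_mem (isBounded_rotatedCube U ρ) (G.pos p)).subset fun z hz =>
      of_not_not fun h => hz (sub_eq_zero.2 (huv p z h))
  rw [← sub_eq_zero, ← hβ.sum_tsum_diff hsupport, ← Finset.sum_sub_distrib]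
  refine Finset.sum_congr rfl fun e _ => ?_
  rw [← mul_sub, ← Finset.sum_sub_distrib, tsum_eq_sum (s := latticePoints T (rotatedCube U ρ')
    (G.pos (G.src e)))]
  · simp only [diff, Pi.sub_apply]
    exact congrArg _ (Finset.sum_congr rfl fun z _ => by ring)
  · intro z hz
    have hsrc : G.loc T (G.src e) z ∉ rotatedCube U ρ := fun h =>
      hz (mem_latticePoints_rotatedCube.2 (rotatedCube_mono (by linarith) h))
    have htgt : G.loc T (G.tgt e) (z + G.off e) ∉ rotatedCube U ρ := fun h =>
      hz (mem_latticePoints_rotatedCube.2 (rotatedCube_mono hρ (loc_src_mem (hR e) h)))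
    simp [diff, huv _ _ hsrc, huv _ _ htgt]

theorem le_graphEnergy (hβ : G.IsCirculation β) (hβ0 : ∀ e, 0 ≤ β e) (hβc : ∀ e, β e ≤ G.cap e)
    (hR : ∀ e, ‖G.disp T e‖ ≤ R) (hR0 : 0 ≤ R) (hρ : 0 ≤ ρ) (hS : ρ + 2 * R ≤ S)
    (hu : ∀ p z, G.loc T p z ∉ rotatedCube U ρ → u p z = G.level T U 0 p z) :
    ∑ e, β e * (slabCount T U (G.pos (G.src e)) 0 (height U (G.disp T e)) (ρ + 2 * R) -
        slabCount T U (G.pos (G.src e)) (height U (G.disp T e)) 0 (ρ + 2 * R)) +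
      ∑ e, G.cap e * (slabCount T U (G.pos (G.src e)) 0 (height U (G.disp T e)) S -
        slabCount T U (G.pos (G.src e)) 0 (height U (G.disp T e)) (ρ + 2 * R)) ≤
      G.graphEnergy T u (rotatedCube U S) := by
  have hinner := sum_mul_diff_le_graphEnergy (T := T) hβ0 hβc u (rotatedCube U (ρ + 2 * R))
  rw [hβ.sum_diff_eq hR hR0 le_rfl hu] at hinner
  simp only [sum_diff_level_zero (hR _) hR0 (show 2 * R ≤ ρ + 2 * R by linarith)] at hinner
  have houter := graphEnergy_sub_eq hR hR0 le_rfl hS hu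
  rw [graphEnergy_level_zero hR (by linarith) (by linarith),
    graphEnergy_level_zero hR (by linarith) (by linarith), ← Finset.sum_sub_distrib] at houter
  simp only [mul_sub _ (slabCount T U _ 0 _ S)]
  linarith

theorem graphEnergy_glued_le (hR : ∀ e, ‖G.disp T e‖ ≤ R) (hR0 : 0 ≤ R)
    (hψ : ∀ p, |ψ p| + R ≤ C) (hC0 : 0 ≤ C) (hC : 2 * C ≤ ρ - 2 * R) (hS : ρ + 2 * R ≤ S) :
    G.graphEnergy T (G.glued T U ψ ρ) (rotatedCube U S) ≤
      ∑ e, G.cap e *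
        (slabCount T U (G.pos (G.src e)) (-ψ (G.src e)) (height U (G.disp T e) - ψ (G.tgt e)) ρ +
          (slabCount T U (G.pos (G.src e)) (-C) C (ρ + 2 * R) -
            slabCount T U (G.pos (G.src e)) (-C) C (ρ - 2 * R))) +
      ∑ e, G.cap e * (slabCount T U (G.pos (G.src e)) 0 (height U (G.disp T e)) S -
        slabCount T U (G.pos (G.src e)) 0 (height U (G.disp T e)) (ρ + 2 * R)) := by
  have hinner : G.graphEnergy T (G.glued T U ψ ρ) (rotatedCube U (ρ + 2 * R)) ≤ _ :=
    Finset.sum_le_sum fun e _ =>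
      mul_le_mul_of_nonneg_left (sum_max_diff_glued_le (hR e) hψ hC) (G.cap_nonneg e)
  have houter := graphEnergy_sub_eq hR hR0 le_rfl hS
    (u := G.glued T U ψ ρ) (v := G.level T U 0) fun p z hz => if_neg hz
  rw [graphEnergy_level_zero hR (by linarith) (by linarith),
    graphEnergy_level_zero hR (by linarith) (by linarith), ← Finset.sum_sub_distrib] at houter
  simp only [mul_sub _ (slabCount T U _ 0 _ S)]
  linarith

end Bounds

end PeriodicGraph

/-! ### Averages of level functions and large-scale limits -/

section Average

variable [NeZero T] {U : Space n ≃ₗᵢ[ℝ] Space n} {s : ℝ}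

theorem slabDensity_sub_slabDensity (x : Space n) (a b : ℝ) :
    slabDensity T U x a b - slabDensity T U x b a =
      cumulativeDensity T U (b - height U x) - cumulativeDensity T U (a - height U x) := by
  rw [slabDensity_eq_max, slabDensity_eq_max, ← neg_sub (cumulativeDensity T U (b - height U x)),
    max_zero_sub_max_neg_zero_eq_self]

theorem integral_cumulativeDensity_add (hs : s ∈ heightGroup T U) (a : ℝ) :
    ∫ t in 0..s, cumulativeDensity T U (a + t) =
      (∫ t in 0..s, cumulativeDensity T U t) + s * a / T ^ (n + 1) := by
  set D : ℝ := (T : ℝ) ^ (n + 1)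
  set f : ℝ → ℝ := fun t => cumulativeDensity T U t - t / D with hf
  have hlin : ∀ a b : ℝ, IntervalIntegrable (fun t => t / D) MeasureTheory.volume a b :=
    fun a b => (continuous_id.div_const D).intervalIntegrable a b
  have hf_int : ∀ a b, IntervalIntegrable f MeasureTheory.volume a b := fun a b =>
    (monotone_cumulativeDensity T U).intervalIntegrable.sub (hlin a b)
  have hperiodic : Function.Periodic f s := fun t => by
    simp only [hf, cumulativeDensity_add hs]
    ring
  have hsplit : ∀ a, ∫ t in a..a + s, cumulativeDensity T U t =
      (∫ t in 0..0 + s, f t) + ((a + s) ^ 2 - a ^ 2) / 2 / D := fun a => by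
    rw [← hperiodic.intervalIntegral_add_eq a 0, ← integral_id, ← intervalIntegral.integral_div,
      ← intervalIntegral.integral_add (hf_int _ _) (hlin _ _)]
    simp only [hf, sub_add_cancel]
  have h0 := hsplit 0
  rw [zero_add] at h0
  rw [intervalIntegral.integral_comp_add_left, add_zero, hsplit, h0, zero_add]
  ring

theorem intervalIntegrable_cumulativeDensity_add (c a b : ℝ) :
    IntervalIntegrable (fun t => cumulativeDensity T U (c + t)) MeasureTheory.volume a b :=
  ((monotone_cumulativeDensity T U).comp (monotone_id.const_add c)).intervalIntegrable

theorem slabDensity_eq_sub {a b : ℝ} (hab : a ≤ b) (x : Space n) :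
    slabDensity T U x a b =
      cumulativeDensity T U (b - height U x) - cumulativeDensity T U (a - height U x) := by
  rw [← slabDensity_sub_slabDensity, slabDensity_of_le hab, sub_zero]

theorem intervalIntegrable_slabDensity (x : Space n) (a b c d : ℝ) :
    IntervalIntegrable (fun t => slabDensity T U x (a + t) (b + t)) MeasureTheory.volume c d := by
  rcases le_total b a with hba | hab
  · simp [slabDensity_of_le (T := T) (U := U) (x := x) (add_le_add_left hba _)]
  simp only [slabDensity_eq_sub (T := T) (U := U) (add_le_add_left hab _) x, add_sub_right_comm]
  exact (intervalIntegrable_cumulativeDensity_add _ c d).sub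
    (intervalIntegrable_cumulativeDensity_add _ c d)

theorem integral_slabDensity (hs : s ∈ heightGroup T U) (x : Space n) (a b : ℝ) :
    ∫ t in 0..s, slabDensity T U x (a + t) (b + t) = s * (max (b - a) 0 / T ^ (n + 1)) := by
  rcases le_total b a with hba | hab
  · simp [slabDensity_of_le (T := T) (U := U) (x := x) (add_le_add_left hba _), hba]
  simp only [slabDensity_eq_sub (T := T) (U := U) (add_le_add_left hab _) x, add_sub_right_comm]
  rw [intervalIntegral.integral_sub (intervalIntegrable_cumulativeDensity_add _ _ _)
    (intervalIntegrable_cumulativeDensity_add _ _ _), integral_cumulativeDensity_add hs,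
    integral_cumulativeDensity_add hs, max_eq_left (sub_nonneg.2 hab)]
  ring

end Average

namespace PeriodicGraph

variable {P E : Type*}

theorem exists_norm_disp_le [Finite E] (G : PeriodicGraph n P E) (T : ℕ) :
    ∃ R, 0 ≤ R ∧ ∀ e, ‖G.disp T e‖ ≤ R :=
  have ⟨R, hR⟩ := (Set.finite_range fun e => ‖G.disp T e‖).bddAbove
  ⟨max R 0, le_max_right _ _, fun e => (hR ⟨e, rfl⟩).trans (le_max_left _ _)⟩

theorem cumulativeDensity_height_disp [NeZero T] {G : PeriodicGraph n P E}
    {U : Space n ≃ₗᵢ[ℝ] Space n} (e : E) :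
    cumulativeDensity T U (height U (G.disp T e) - height U (G.pos (G.src e))) =
      cumulativeDensity T U (-height U (G.pos (G.tgt e))) +
        (height U (G.disp T e) - height U (G.pos (G.src e)) + height U (G.pos (G.tgt e))) /
          T ^ (n + 1) := by
  rw [← cumulativeDensity_add]
  · congr 1
    ring
  · convert (heightGroup T U).neg_mem (height_shift_mem_heightGroup T U (G.off e)) using 1
    rw [disp, map_sub, map_sub]
    ring

section Limits

variable [Fintype E]

/-- The energy per unit area of the half-space. -/
def halfSpaceDensity (G : PeriodicGraph n P E) (T : ℕ) (U : Space n ≃ₗᵢ[ℝ] Space n) : ℝ :=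
  ∑ e, G.cap e * slabDensity T U (G.pos (G.src e)) 0 (height U (G.disp T e))

/-- The component in the direction of the height of the mean over a period of a flow `β`. -/
def fluxDensity (G : PeriodicGraph n P E) (T : ℕ) (U : Space n ≃ₗᵢ[ℝ] Space n) (β : E → ℝ) : ℝ :=
  (∑ e, β e * height U (G.disp T e)) / T ^ (n + 1)

/-- The mean over a period of the total variation of the height corrected by the periodic
function `q`. -/
def potentialDensity (G : PeriodicGraph n P E) (T : ℕ) (U : Space n ≃ₗᵢ[ℝ] Space n)
    (q : P → ℝ) : ℝ :=
  (∑ e, G.cap e * max (height U (G.disp T e) + q (G.src e) - q (G.tgt e)) 0) / T ^ (n + 1)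

variable [NeZero T] {G : PeriodicGraph n P E} {U : Space n ≃ₗᵢ[ℝ] Space n} {l g : ℝ} {β : E → ℝ}

theorem IsCirculation.sum_slabDensity_sub (hβ : G.IsCirculation β) :
    ∑ e, β e * (slabDensity T U (G.pos (G.src e)) 0 (height U (G.disp T e)) -
      slabDensity T U (G.pos (G.src e)) (height U (G.disp T e)) 0) = G.fluxDensity T U β := by
  set q : P → ℝ := fun p =>
    cumulativeDensity T U (-height U (G.pos p)) + height U (G.pos p) / T ^ (n + 1) with hq
  have hterm (e : E) : slabDensity T U (G.pos (G.src e)) 0 (height U (G.disp T e)) -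
      slabDensity T U (G.pos (G.src e)) (height U (G.disp T e)) 0 =
      height U (G.disp T e) / T ^ (n + 1) - (q (G.src e) - q (G.tgt e)) := by
    rw [slabDensity_sub_slabDensity, cumulativeDensity_height_disp, zero_sub, hq]
    ring
  simp only [hterm, mul_sub (β _) (_ / _), Finset.sum_sub_distrib, hβ q, sub_zero, fluxDensity,
    Finset.sum_div, mul_div_assoc]

theorem integral_sum_slabDensity {s : ℝ} (hs : s ∈ heightGroup T U) (q : P → ℝ) :
    ∫ t in 0..s, ∑ e, G.cap e * slabDensity T U (G.pos (G.src e)) (-q (G.src e) + t)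
      (height U (G.disp T e) - q (G.tgt e) + t) = s * G.potentialDensity T U q := by
  rw [intervalIntegral.integral_finsetSum fun e _ =>
    (intervalIntegrable_slabDensity _ _ _ _ _).const_mul _, potentialDensity, Finset.sum_div,
    Finset.mul_sum]
  refine Finset.sum_congr rfl fun e _ => ?_
  rw [intervalIntegral.integral_const_mul, integral_slabDensity hs]
  ring_nf

/-- Some translate of the level function of `q` costs at most the average over all translates. -/
theorem exists_level_density_le (q : P → ℝ) : ∃ ψ : P → ℝ,
    ∑ e, G.cap e * slabDensity T U (G.pos (G.src e)) (-ψ (G.src e))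
      (height U (G.disp T e) - ψ (G.tgt e)) ≤ G.potentialDensity T U q := by
  obtain ⟨z, hz⟩ := exists_height_shift_pos T U
  have hs := height_shift_mem_heightGroup T U z
  set s := height U (shift T z)
  obtain ⟨t, -, ht⟩ := MeasureTheory.exists_le_setAverage
    (by simpa [Set.uIoc_of_le hz.le] using hz) (by simp [Set.uIoc_of_le hz.le])
    (IntervalIntegrable.sum Finset.univ fun e _ => (intervalIntegrable_slabDensity (T := T)
      (U := U) (G.pos (G.src e)) (-q (G.src e)) (height U (G.disp T e) - q (G.tgt e)) 0 s).const_mul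
        (G.cap e)).def'
  rw [interval_average_eq_div] at ht
  simp only [Finset.sum_apply] at ht
  rw [integral_sum_slabDensity hs, sub_zero, mul_div_cancel_left₀ _ hz.ne'] at ht
  refine ⟨fun p => q p - t, le_of_eq_of_le (Finset.sum_congr rfl fun e _ => ?_) ht⟩
  ring_nf

theorem tendsto_sum_slabCount_sub (hl : 0 < l) (k : ℝ) :
    Tendsto (fun S => (∑ e, G.cap e * (slabCount T U (G.pos (G.src e)) 0 (height U (G.disp T e)) S -
        slabCount T U (G.pos (G.src e)) 0 (height U (G.disp T e)) (l * S + k))) / S ^ n) atTop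
      (𝓝 ((1 - l ^ n) * G.halfSpaceDensity T U)) := by
  simp only [Finset.sum_div, mul_div_assoc, sub_div, halfSpaceDensity, Finset.mul_sum,
    mul_left_comm (1 - l ^ n), sub_mul, one_mul]
  exact tendsto_finsetSum _ fun e _ =>
    ((tendsto_slabCount T U _ _ _).sub (tendsto_slabCount_affine T U _ _ _ hl k)).const_mul _

theorem eventually_lt_graphEnergy (hβ : G.IsCirculation β) (hβ0 : ∀ e, 0 ≤ β e)
    (hβc : ∀ e, β e ≤ G.cap e) (hl : 0 < l) (hl1 : l < 1)
    (hg : g < l ^ n * G.fluxDensity T U β + (1 - l ^ n) * G.halfSpaceDensity T U) :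
    ∀ᶠ S in atTop, ∀ u : P → (Fin (n + 1) → ℤ) → ℝ,
      (∀ p z, G.loc T p z ∉ rotatedCube U (l * S) → u p z = G.level T U 0 p z) →
      g < G.graphEnergy T u (rotatedCube U S) / S ^ n := by
  obtain ⟨R, hR0, hR⟩ := G.exists_norm_disp_le T
  have hinner : Tendsto (fun S => (∑ e, β e *
      (slabCount T U (G.pos (G.src e)) 0 (height U (G.disp T e)) (l * S + 2 * R) -
        slabCount T U (G.pos (G.src e)) (height U (G.disp T e)) 0 (l * S + 2 * R))) / S ^ n) atTop
      (𝓝 (l ^ n * G.fluxDensity T U β)) := by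
    simp only [← hβ.sum_slabDensity_sub, Finset.sum_div, mul_div_assoc, sub_div, Finset.mul_sum,
      mul_left_comm (l ^ n), mul_sub (l ^ n)]
    exact tendsto_finsetSum _ fun e _ => ((tendsto_slabCount_affine T U _ _ _ hl _).sub
      (tendsto_slabCount_affine T U _ _ _ hl _)).const_mul _
  have hlarge : ∀ᶠ S in atTop, 2 * R / (1 - l) ≤ S := eventually_ge_atTop _
  filter_upwards [(hinner.add (tendsto_sum_slabCount_sub hl _)).eventually_const_lt hg, hlarge,
    eventually_gt_atTop 0] with S hS hRS hS0 u hu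
  rw [div_le_iff₀' (sub_pos.2 hl1)] at hRS
  refine hS.trans_le ?_
  rw [← add_div]
  gcongr
  exact le_graphEnergy hβ hβ0 hβc hR hR0 (by positivity) (by linarith) hu

theorem eventually_exists_graphEnergy_lt [Finite P] (q : P → ℝ) (hl : 0 < l) (hl1 : l < 1)
    (hg : l ^ n * G.potentialDensity T U q + (1 - l ^ n) * G.halfSpaceDensity T U < g) :
    ∀ᶠ S in atTop, ∃ u : P → (Fin (n + 1) → ℤ) → ℝ, (∀ p z, u p z = 0 ∨ u p z = 1) ∧
      (∀ p z, G.loc T p z ∉ rotatedCube U (l * S) → u p z = G.level T U 0 p z) ∧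
      G.graphEnergy T u (rotatedCube U S) / S ^ n < g := by
  obtain ⟨R, hR0, hR⟩ := G.exists_norm_disp_le T
  obtain ⟨ψ, hψ⟩ := exists_level_density_le (G := G) (T := T) (U := U) q
  obtain ⟨K, hK⟩ := (Set.finite_range fun p => |ψ p|).bddAbove
  set C := max K 0 + R
  have hψC : ∀ p, |ψ p| + R ≤ C := fun p =>
    add_le_add_left ((hK ⟨p, rfl⟩).trans (le_max_left _ _)) R
  have hC0 : 0 ≤ C := by positivity
  have hinner := tendsto_finsetSum Finset.univ fun e _ =>
    ((tendsto_slabCount_affine T U (G.pos (G.src e)) (-ψ (G.src e))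
      (height U (G.disp T e) - ψ (G.tgt e)) hl 0).add
    ((tendsto_slabCount_affine T U (G.pos (G.src e)) (-C) C hl (2 * R)).sub
      (tendsto_slabCount_affine T U (G.pos (G.src e)) (-C) C hl (-(2 * R))))).const_mul (G.cap e)
  simp only [sub_self, add_zero, mul_left_comm _ (l ^ n), ← Finset.mul_sum, ← sub_eq_add_neg,
    ← add_div, ← sub_div, ← mul_div_assoc, ← Finset.sum_div] at hinner
  have hlim : l ^ n * _ + (1 - l ^ n) * G.halfSpaceDensity T U < g :=
    (add_le_add_left (mul_le_mul_of_nonneg_left hψ (by positivity)) _).trans_lt hg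
  filter_upwards [(hinner.add (tendsto_sum_slabCount_sub hl _)).eventually_lt_const hlim,
    eventually_ge_atTop ((2 * C + 2 * R) / l), eventually_ge_atTop (2 * R / (1 - l)),
    eventually_gt_atTop 0] with S hS hCS hRS hS0
  rw [div_le_iff₀' hl] at hCS
  rw [div_le_iff₀' (sub_pos.2 hl1)] at hRS
  refine ⟨G.glued T U ψ (l * S), glued_eq_zero_or_one ψ _, fun p z hz => if_neg hz,
    lt_of_le_of_lt ?_ hS⟩
  rw [← add_div]
  gcongr
  exact graphEnergy_glued_le hR hR0 hψC hC0 (by linarith) (by linarith)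

end Limits

end PeriodicGraph

/-! ### Potentials dual to circulations -/

section Duality

open Set

theorem exists_lagrangeMultiplier {X F : Type*} [AddCommGroup X] [Module ℝ X] [TopologicalSpace X]
    [AddCommGroup F] [Module ℝ F] [TopologicalSpace F] [IsTopologicalAddGroup F]
    [ContinuousSMul ℝ F] [LocallyConvexSpace ℝ F] [T1Space F] {K : Set X} (hconv : Convex ℝ K)
    (hK : IsCompact K) (A : X →L[ℝ] F) (ℓ : X →L[ℝ] ℝ) (hA : ∃ x ∈ K, A x = 0) {m M : ℝ}
    (hm : ∀ x ∈ K, A x = 0 → ℓ x ≤ m) (hmM : m < M) :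
    ∃ g : F →L[ℝ] ℝ, ∀ x ∈ K, ℓ x + g (A x) ≤ M := by
  have hdisj : Disjoint (A.prod ℓ '' K) ({0} ×ˢ Ici M) := by
    refine disjoint_left.2 ?_
    rintro _ ⟨x, hx, rfl⟩ ⟨hAx, hMx⟩
    exact (hmM.trans_le hMx).not_ge (hm x hx hAx)
  obtain ⟨f, a, b, hfa, hab, hfb⟩ := geometric_hahn_banach_compact_closed
    (hconv.linear_image (A.prod ℓ).toLinearMap) (hK.image (A.prod ℓ).continuous)
    ((convex_singleton 0).prod (convex_Ici M)) (isClosed_singleton.prod isClosed_Ici) hdisj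
  set s := f (0, 1)
  have hf (x : F) (y : ℝ) : f (x, y) = f (x, 0) + y * s := by
    rw [← smul_eq_mul, ← map_smul, ← map_add]
    simp
  have hlt : ∀ x ∈ K, f (A x, 0) + ℓ x * s < M * s := fun x hx => by
    have h := (hfa _ ⟨x, hx, rfl⟩).trans (hab.trans (hfb (0, M) ⟨rfl, self_mem_Ici⟩))
    rwa [hf 0, ← Prod.zero_eq_mk, map_zero, zero_add, ContinuousLinearMap.coe_coe,
      ContinuousLinearMap.prod_apply, hf] at h
  have hs : 0 < s := by
    obtain ⟨x, hx, hAx⟩ := hA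
    have h := hlt x hx
    rw [hAx, ← Prod.zero_eq_mk, map_zero, zero_add, ← sub_pos, ← sub_mul] at h
    exact pos_of_mul_pos_right h (sub_nonneg.2 ((hm x hx hAx).trans hmM.le))
  refine ⟨s⁻¹ • f.comp (.inl ℝ F ℝ), fun x hx => le_of_mul_le_mul_right ?_ hs⟩
  refine le_of_eq_of_le ?_ (hlt x hx).le
  simp [add_mul, mul_right_comm, hs.ne', add_comm]

end Duality

namespace PeriodicGraph

variable {P E : Type*} [Fintype E]

/-- The subspace of circulations. -/
def circulations (G : PeriodicGraph n P E) : Submodule ℝ (E → ℝ) where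
  carrier := {β | G.IsCirculation β}
  zero_mem' q := by simp
  add_mem' hβ hγ q := by simp [add_mul, Finset.sum_add_distrib, hβ q, hγ q]
  smul_mem' t β hβ q := by simp [mul_assoc, ← Finset.mul_sum, hβ q]

open Classical in
/-- The net flow out of the nodes of the quotient graph. -/
def netFlow (G : PeriodicGraph n P E) : (E → ℝ) →ₗ[ℝ] (P → ℝ) :=
  Fintype.linearCombination ℝ fun e => Pi.single (G.src e) 1 - Pi.single (G.tgt e) 1

variable {G : PeriodicGraph n P E} {β : E → ℝ}

open Classical in
theorem map_netFlow (f : (P → ℝ) →ₗ[ℝ] ℝ) (β : E → ℝ) :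
    f (G.netFlow β) =
      ∑ e, β e * (f (Pi.single (G.src e) 1) - f (Pi.single (G.tgt e) 1)) := by
  simp [netFlow, Fintype.linearCombination_apply]

theorem isCirculation_of_netFlow_eq_zero [Finite P] (h : G.netFlow β = 0) :
    G.IsCirculation β := fun q => by
  classical
  have := Fintype.ofFinite P
  simpa [h] using (map_netFlow (G := G) (Fintype.linearCombination ℝ q) β).symm

theorem isCirculation_iff [Finite P] [DecidableEq P] :
    G.IsCirculation β ↔ ∀ p, ∑ e with G.src e = p, β e = ∑ e with G.tgt e = p, β e := by
  refine ⟨fun h p => ?_, fun h => isCirculation_of_netFlow_eq_zero (funext fun p => ?_)⟩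
  · simpa [Pi.single_apply, mul_sub, Finset.sum_filter, sub_eq_zero] using h (Pi.single p 1)
  · simpa [netFlow, Fintype.linearCombination_apply, Pi.single_apply, mul_sub, Finset.sum_filter,
      sub_eq_zero, @eq_comm _ p] using h p

theorem exists_potential [Finite P] (η : E → ℝ) {m M : ℝ}
    (hm : ∀ β ∈ Set.Icc 0 G.cap, G.IsCirculation β → ∑ e, β e * η e ≤ m) (hmM : m < M) :
    ∃ q : P → ℝ, ∑ e, G.cap e * max (η e + q (G.src e) - q (G.tgt e)) 0 ≤ M := by
  classical
  obtain ⟨g, hg⟩ := exists_lagrangeMultiplier (convex_Icc 0 G.cap) isCompact_Icc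
    G.netFlow.toContinuousLinearMap (Fintype.linearCombination ℝ η).toContinuousLinearMap
    ⟨0, ⟨le_rfl, G.cap_nonneg⟩, map_zero _⟩
    (fun β hβ h => hm β hβ (isCirculation_of_netFlow_eq_zero h)) hmM
  set q : P → ℝ := fun p => g (Pi.single p 1)
  set β : E → ℝ := fun e => if 0 ≤ η e + q (G.src e) - q (G.tgt e) then G.cap e else 0 with hβ
  have hβmem : β ∈ Set.Icc 0 G.cap := by
    refine ⟨fun e => ?_, fun e => ?_⟩ <;> simp only [hβ] <;> split_ifs
    exacts [G.cap_nonneg e, le_rfl, le_rfl, G.cap_nonneg e]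
  refine ⟨q, le_of_eq_of_le ?_ (hg β hβmem)⟩
  have hflow : g (G.netFlow β) = ∑ e, β e * (q (G.src e) - q (G.tgt e)) :=
    map_netFlow g.toLinearMap β
  rw [LinearMap.coe_toContinuousLinearMap', LinearMap.coe_toContinuousLinearMap', hflow,
    Fintype.linearCombination_apply, ← Finset.sum_add_distrib]
  refine Finset.sum_congr rfl fun e _ => ?_
  simp only [hβ, smul_eq_mul, ← mul_add, ← add_sub_assoc]
  split_ifs with h
  · rw [max_eq_left h]
  · rw [max_eq_right (not_le.1 h).le, mul_zero, zero_mul]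

end PeriodicGraph

/-! ### Extreme points of linear images of sections of boxes -/

section Polytope

variable {E : Type*} (V : Submodule ℝ (E → ℝ)) (c : E → ℝ)

/-- The section of the box `∏ [0, c e]` by a subspace. -/
def boxSection : Set (E → ℝ) := V ∩ Set.univ.pi fun e => Set.Icc 0 (c e)

theorem convex_boxSection : Convex ℝ (boxSection V c) :=
  V.convex.inter (convex_pi fun _ _ => convex_Icc _ _)

/-- Which of the constraints `0 ≤ x e ≤ c e` are active. -/
def activePattern (x : E → ℝ) (e : E) : Fin 3 :=
  if x e = 0 then 0 else if x e = c e then 1 else 2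

variable {V c} in
theorem eventually_lineMap_mem_Icc {x y : E → ℝ} (hx : x ∈ boxSection V c)
    (hxy : activePattern c x = activePattern c y) (e : E) :
    ∀ᶠ t in 𝓝 (0 : ℝ), x e + t * (x e - y e) ∈ Set.Icc 0 (c e) := by
  have hxe := hx.2 e trivial
  have hpattern := congrFun hxy e
  rcases eq_or_ne (x e) (y e) with heq | hne
  · simpa [heq] using heq ▸ hxe
  have h0 : x e ≠ 0 := by grind [activePattern]
  have hc : x e ≠ c e := by grind [activePattern]
  have hlim : Tendsto (fun t => x e + t * (x e - y e)) (𝓝 0) (𝓝 (x e)) := by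
    simpa using ((continuous_mul_const (x e - y e)).const_add (x e)).tendsto 0
  exact hlim.eventually (Icc_mem_nhds (hxe.1.lt_of_ne' h0) (hxe.2.lt_of_ne hc))

theorem isCompact_boxSection [Finite E] : IsCompact (boxSection V c) :=
  (isCompact_univ_pi fun _ => isCompact_Icc).inter_left V.closed_of_finiteDimensional

theorem injOn_activePattern [Finite E] :
    Set.InjOn (activePattern c) ((boxSection V c).extremePoints ℝ) := by
  intro x hx y hy hxy
  have hev : ∀ᶠ t in 𝓝[>] (0 : ℝ), ∀ e, x e + t * (x e - y e) ∈ Set.Icc 0 (c e) :=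
    eventually_nhdsWithin_of_eventually_nhds
      (eventually_all.2 (eventually_lineMap_mem_Icc hx.1 hxy))
  obtain ⟨t, ht, ht0 : 0 < t⟩ := (hev.and self_mem_nhdsWithin).exists
  have hmem : x + t • (x - y) ∈ boxSection V c :=
    ⟨V.add_mem hx.1.1 (V.smul_mem t (V.sub_mem hx.1.1 hy.1.1)), fun e _ => ht e⟩
  refine (hx.2 hy.1 hmem ⟨t / (1 + t), 1 / (1 + t), by positivity, by positivity, ?_, ?_⟩).symm
  · field_simp
    ring
  · ext e
    simp
    field_simp
    ring

theorem encard_extremePoints_boxSection_le [Fintype E] :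
    ((boxSection V c).extremePoints ℝ).encard ≤ 3 ^ Fintype.card E := by
  classical
  rw [← (injOn_activePattern V c).encard_image]
  refine (Set.encard_le_encard (Set.subset_univ _)).trans ?_
  simp [Set.encard_univ]

variable {F : Type*} [AddCommGroup F] [Module ℝ F] [TopologicalSpace F] [IsTopologicalAddGroup F]
  [ContinuousSMul ℝ F] [T2Space F] (f : (E → ℝ) →ₗ[ℝ] F)

theorem encard_extremePoints_image_boxSection_le [Fintype E] :
    ((f '' boxSection V c).extremePoints ℝ).encard ≤ 3 ^ Fintype.card E :=
  (Set.encard_le_encard (surjOn_extremePoints_image f.toContinuousLinearMap.toContinuousAffineMap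
    (isCompact_boxSection V c))).trans
    ((Set.encard_image_le _ _).trans (encard_extremePoints_boxSection_le V c))

theorem convexHull_extremePoints_of_finite [LocallyConvexSpace ℝ F] {W : Set F}
    (hW : IsCompact W) (hconv : Convex ℝ W) (hfin : (W.extremePoints ℝ).Finite) :
    convexHull ℝ (W.extremePoints ℝ) = W := by
  rw [← (hfin.isClosed_convexHull (𝕜 := ℝ)).closure_eq, closure_convexHull_extremePoints hW hconv]

end Polytope

section SupportFunction

variable {F : Type*} [NormedAddCommGroup F] [InnerProductSpace ℝ F]

/-- The support function of a set. -/
def supportFunction (W : Set F) (ν : F) : ℝ := sSup ((fun ζ => inner ℝ ν ζ) '' W)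

variable {W : Set F} {ζ ν : F} {r t : ℝ}

theorem isLUB_supportFunction (hW : IsCompact W) (hne : W.Nonempty) (ν : F) :
    IsLUB ((fun ζ => inner ℝ ν ζ) '' W) (supportFunction W ν) :=
  isLUB_csSup (hne.image _) (hW.image (by fun_prop)).bddAbove

theorem inner_le_supportFunction (hW : IsCompact W) (hζ : ζ ∈ W) (ν : F) :
    inner ℝ ν ζ ≤ supportFunction W ν :=
  (isLUB_supportFunction hW ⟨ζ, hζ⟩ ν).1 ⟨ζ, hζ, rfl⟩

theorem supportFunction_le (hW : IsCompact W) (hne : W.Nonempty) (h : ∀ ζ ∈ W, inner ℝ ν ζ ≤ r) :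
    supportFunction W ν ≤ r :=
  (isLUB_supportFunction hW hne ν).2 (Set.forall_mem_image.2 h)

theorem convexOn_supportFunction (hW : IsCompact W) (hne : W.Nonempty) :
    ConvexOn ℝ Set.univ (supportFunction W) := by
  refine ⟨convex_univ, fun x _ y _ a b ha hb _ => supportFunction_le hW hne fun ζ hζ => ?_⟩
  rw [inner_add_left, real_inner_smul_left, real_inner_smul_left, smul_eq_mul, smul_eq_mul]
  gcongr <;> exact inner_le_supportFunction hW hζ _

theorem supportFunction_smul (ht : 0 ≤ t) (ν : F) :
    supportFunction W (t • ν) = t * supportFunction W ν := by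
  simp only [supportFunction, real_inner_smul_left]
  rw [← smul_eq_mul, ← Real.sSup_smul_of_nonneg ht, ← Set.image_smul, Set.image_image]
  simp only [smul_eq_mul]

theorem mem_of_forall_inner_le_supportFunction [CompleteSpace F] (hW : IsCompact W)
    (hconv : Convex ℝ W) (hne : W.Nonempty) (h : ∀ ν, inner ℝ ν ζ ≤ supportFunction W ν) :
    ζ ∈ W := by
  by_contra hζ
  obtain ⟨f, u, hfu, huf⟩ := geometric_hahn_banach_closed_point hconv hW.isClosed hζ
  obtain ⟨ν, rfl⟩ := (InnerProductSpace.toDual ℝ F).surjective f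
  exact ((h ν).trans (supportFunction_le hW hne fun w hw => (hfu w hw).le)).not_gt huf

end SupportFunction

theorem wulffSet_supportFunction {W : Set (Space n)} (hW : IsCompact W) (hconv : Convex ℝ W)
    (hne : W.Nonempty) : wulffSet (supportFunction W) = W := by
  refine Set.Subset.antisymm (fun ζ hζ => ?_) fun ζ hζ ν _ => ?_
  · refine mem_of_forall_inner_le_supportFunction hW hconv hne fun ν => ?_
    rcases eq_or_ne ν 0 with rfl | hν
    · simpa using (supportFunction_smul (W := W) le_rfl (0 : Space n)).ge
    · have hunit := hζ (‖ν‖⁻¹ • ν) (norm_smul_inv_norm (𝕜 := ℝ) hν)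
      rw [supportFunction_smul (by positivity), real_inner_smul_right, real_inner_comm] at hunit
      exact le_of_mul_le_mul_left hunit (by positivity)
  · rw [real_inner_comm]
    exact inner_le_supportFunction hW hζ ν

/-! ### The quotient graph of a periodic interaction -/

section Finiteness

variable {L : Set (Space n)}

theorem IsDiscreteSet.finite_inter (hL : IsDiscreteSet L) {A : Set (Space n)}
    (hA : Bornology.IsBounded A) : {i : L | (i : Space n) ∈ A}.Finite := by
  obtain ⟨r, hr, hsep⟩ := hL
  obtain ⟨t, -, htf, ht⟩ := Metric.finite_approx_of_totallyBounded
    (hA.isCompact_closure.totallyBounded.subset subset_closure) (r / 2) (by positivity)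
  have hex : ∀ i : L, (i : Space n) ∈ A → ∃ y ∈ t, dist (i : Space n) y < r / 2 := fun i hi => by
    simpa using ht hi
  choose! f hft hfdist using hex
  refine Set.Finite.of_finite_image (htf.subset (Set.image_subset_iff.2 hft))
    fun i hi j hj hij => ?_
  by_contra hne
  have hlt : dist (i : Space n) j < r / 2 + r / 2 :=
    (dist_triangle_right _ _ (f i)).trans_lt (add_lt_add (hfdist i hi) (hij ▸ hfdist j hj))
  linarith [hsep i i.2 j j.2 (Subtype.coe_ne_coe.2 hne)]

variable (T L) in
/-- The points of `L` in the cell `Q_T`; they are the nodes of the quotient graph. -/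
abbrev CellPoint : Type := {i : L // (i : Space n) ∈ cube n T}

theorem IsDiscreteSet.finite_cellPoint (hL : IsDiscreteSet L) (T : ℕ) : Finite (CellPoint T L) :=
  (hL.finite_inter (isBounded_cube T)).to_subtype

theorem finite_edges (hL : IsDiscreteSet L) {c : L → L → ℝ≥0} (hc : HasFiniteRange c) (T : ℕ) :
    (edges T c).Finite := by
  obtain ⟨R, -, hR⟩ := hc
  refine ((hL.finite_inter (isBounded_cube T)).prod
    (hL.finite_inter ((isBounded_cube T).thickening (δ := R)))).subset ?_
  rintro ⟨i, j⟩ ⟨hi, hij⟩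
  refine ⟨hi, Metric.mem_thickening_iff.2 ⟨i, hi, ?_⟩⟩
  rw [dist_comm]
  exact not_le.1 fun h => hij (hR i j h)

end Finiteness

section Translate

variable {L : Set (Space n)} (hL : IsPeriodicSet T L)

/-- The translate of a point of a periodic set by `T z`. -/
def translate (i : L) (z : Fin (n + 1) → ℤ) : L :=
  ⟨i + shift T z, (hL z).subset ⟨i, i.2, rfl⟩⟩

theorem translate_translate (i : L) (z w : Fin (n + 1) → ℤ) :
    translate hL (translate hL i z) w = translate hL i (z + w) :=
  Subtype.ext (by simp only [translate, shift_add, add_assoc])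

theorem translate_zero (i : L) : translate hL i 0 = i :=
  Subtype.ext (by simp only [translate, shift_zero, add_zero])

theorem translate_injective (z : Fin (n + 1) → ℤ) : Function.Injective (translate hL · z) :=
  fun _ _ h => Subtype.ext (add_right_cancel (congrArg Subtype.val h))

theorem IsPeriodicKernel.apply_translate {X : Type} {a : L → L → X} (ha : IsPeriodicKernel T a)
    (i j : L) (z : Fin (n + 1) → ℤ) : a (translate hL i z) (translate hL j z) = a i j :=
  ha z i j _ _ rfl rfl

variable [NeZero T]

/-- Every point of a periodic set is the translate of a unique point of the cell `Q_T` by a unique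
vector `T z`. -/
def cellEquiv : L ≃ CellPoint T L × (Fin (n + 1) → ℤ) where
  toFun i := (⟨translate hL i (-cellIndex T (i : Space n)), by
    simpa only [translate, shift_neg, ← sub_eq_add_neg] using
      sub_shift_cellIndex_mem _⟩, cellIndex T (i : Space n))
  invFun x := translate hL x.1 x.2
  left_inv i := by simp only [translate_translate, neg_add_cancel, translate_zero]
  right_inv x := by
    have hindex : cellIndex T (translate hL x.1 x.2 : Space n) = x.2 := cellIndex_add_shift x.1.2 _
    refine Prod.ext (Subtype.ext ?_) hindex
    simp only [hindex, translate_translate, add_neg_cancel, translate_zero]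

theorem translate_cellEquiv (i : L) :
    translate hL (cellEquiv hL i).1 (cellEquiv hL i).2 = i :=
  (cellEquiv hL).symm_apply_apply i

theorem cellEquiv_translate (p : CellPoint T L) (z : Fin (n + 1) → ℤ) :
    cellEquiv hL (translate hL p z) = (p, z) :=
  (cellEquiv hL).apply_symm_apply (p, z)

/-- The quotient of the interaction graph of `c` by the translations `T ℤ^d`. -/
def quotientGraph (c : L → L → ℝ≥0) : PeriodicGraph n (CellPoint T L) (edges T c) where
  pos p := p.1
  src e := ⟨e.1.1, e.2.1⟩
  tgt e := (cellEquiv hL e.1.2).1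
  off e := (cellEquiv hL e.1.2).2
  cap e := c e.1.1 e.1.2
  cap_nonneg _ := NNReal.coe_nonneg _

variable {c : L → L → ℝ≥0}

theorem translate_tgt (e : edges T c) (z : Fin (n + 1) → ℤ) :
    translate hL ((quotientGraph hL c).tgt e) (z + (quotientGraph hL c).off e) =
      translate hL e.1.2 z := by
  rw [add_comm, ← translate_translate]
  exact congrArg (translate hL · z) (translate_cellEquiv hL _)

theorem disp_quotientGraph (e : edges T c) :
    (quotientGraph hL c).disp T e = (e.1.1 : Space n) - e.1.2 := by
  have h := congrArg Subtype.val (translate_cellEquiv hL e.1.2)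
  simp only [translate] at h
  rw [← h, ← sub_sub]
  rfl

/-- The edge of the interaction graph that is represented by an edge of the quotient graph and a
translation. -/
def edgeTranslate (x : edges T c × (Fin (n + 1) → ℤ)) : L × L :=
  (translate hL x.1.1.1 x.2, translate hL x.1.1.2 x.2)

theorem edgeTranslate_injective :
    Function.Injective (edgeTranslate hL : edges T c × (Fin (n + 1) → ℤ) → L × L) := by
  rintro ⟨e, z⟩ ⟨e', z'⟩ h
  have hsrc : ((quotientGraph hL c).src e, z) = ((quotientGraph hL c).src e', z') :=
    (cellEquiv hL).symm.injective (congrArg Prod.fst h)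
  obtain rfl : z = z' := congrArg Prod.snd hsrc
  exact Prod.ext (Subtype.ext (Prod.ext (translate_injective hL z (congrArg Prod.fst h))
    (translate_injective hL z (congrArg Prod.snd h)))) rfl

theorem mem_range_edgeTranslate (hc : IsPeriodicKernel T c) {x : L × L} :
    x ∈ Set.range (edgeTranslate hL : edges T c × (Fin (n + 1) → ℤ) → L × L) ↔ c x.1 x.2 ≠ 0 := by
  constructor
  · rintro ⟨⟨e, z⟩, rfl⟩
    exact (hc.apply_translate hL _ _ z).trans_ne e.2.2
  · intro h
    have hmem := (cellEquiv hL x.1).1.2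
    rw [← hc.apply_translate hL _ _ (-(cellEquiv hL x.1).2)] at h
    refine ⟨(⟨((cellEquiv hL x.1).1, translate hL x.2 (-(cellEquiv hL x.1).2)), hmem, h⟩,
      (cellEquiv hL x.1).2), Prod.ext (translate_cellEquiv hL x.1) ?_⟩
    simp only [edgeTranslate, translate_translate, neg_add_cancel, translate_zero]

/-! ### Energy and fluxes in terms of the quotient graph -/

theorem energy_eq_tsum (c : L → L → ℝ≥0) (u : L → ℝ) (A : Set (Space n)) :
    energy c u A = ∑' x : L × L, {x : L × L | (x.1 : Space n) ∈ A}.indicator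
      (fun x => (c x.1 x.2 : ℝ≥0∞) * ENNReal.ofReal (u x.1 - u x.2)) x := by
  rw [ENNReal.tsum_prod', energy]
  refine (tsum_subtype {i : L | (i : Space n) ∈ A} fun i =>
    ∑' j : L, (c i j : ℝ≥0∞) * ENNReal.ofReal (u i - u j)).trans (tsum_congr fun i => ?_)
  by_cases hi : (i : Space n) ∈ A <;> simp [hi]

theorem energy_eq_graphEnergy [Fintype (edges T c)] (hc : IsPeriodicKernel T c) (u : L → ℝ)
    {A : Set (Space n)} (hA : Bornology.IsBounded A) :
    energy c u A = ENNReal.ofReal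
      ((quotientGraph hL c).graphEnergy T (fun p z => u (translate hL p z)) A) := by
  set G := quotientGraph hL c
  have hnonneg : ∀ e, 0 ≤ ∑ z ∈ latticePoints T A (G.pos (G.src e)),
      max (G.diff (fun p z => u (translate hL p z)) e z) 0 :=
    fun e => Finset.sum_nonneg fun z _ => le_max_right _ _
  rw [energy_eq_tsum, ← (edgeTranslate_injective hL (c := c)).tsum_eq, ENNReal.tsum_prod',
    tsum_fintype, PeriodicGraph.graphEnergy,
    ENNReal.ofReal_sum_of_nonneg fun e _ => mul_nonneg (G.cap_nonneg e) (hnonneg e)]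
  · refine Finset.sum_congr rfl fun e _ => ?_
    have hmem (z) : z ∈ latticePoints T A (G.pos (G.src e)) ↔
        edgeTranslate hL (e, z) ∈ {x : L × L | (x.1 : Space n) ∈ A} := mem_latticePoints hA
    rw [Finset.mul_sum, ENNReal.ofReal_sum_of_nonneg fun z _ =>
      mul_nonneg (G.cap_nonneg e) (le_max_right _ _),
      tsum_eq_sum fun z hz => Set.indicator_of_notMem (mt (hmem z).2 hz) _]
    refine Finset.sum_congr rfl fun z hz => ?_
    rw [Set.indicator_of_mem ((hmem z).1 hz),
      ENNReal.ofReal_mul (G.cap_nonneg e), ENNReal.ofReal_max, ENNReal.ofReal_zero,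
      max_eq_left zero_le, PeriodicGraph.diff, translate_tgt hL]
    simp only [edgeTranslate, hc.apply_translate hL]
    simp [G, quotientGraph]
  · intro x hx
    refine (mem_range_edgeTranslate hL hc).2 fun h => hx ?_
    simp [h]

theorem hasSum_out [Fintype (edges T c)] [DecidableEq (CellPoint T L)] {X : Type*}
    [AddCommMonoid X] [TopologicalSpace X] {F : L → L → X} (hF : ∀ i j, c i j = 0 → F i j = 0)
    (p : CellPoint T L) :
    HasSum (F p) (∑ e with (quotientGraph hL c).src e = p, F e.1.1 e.1.2) := by
  classical
  set s : Finset (edges T c) := {e | (quotientGraph hL c).src e = p}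
  have hsrc : ∀ e ∈ s, e.1.1 = p.1 := fun e he =>
    congrArg Subtype.val (Finset.mem_filter.1 he).2
  have hinj : Set.InjOn (fun e : edges T c => e.1.2) s := fun e he e' he' h =>
    Subtype.ext (Prod.ext ((hsrc e he).trans (hsrc e' he').symm) h)
  rw [Finset.sum_congr rfl fun e he => by rw [hsrc e he], ← Finset.sum_image (f := F p) hinj]
  refine hasSum_sum_of_ne_finset_zero fun j hj => hF _ _ (by_contra fun h => hj ?_)
  exact Finset.mem_image.2 ⟨⟨(p, j), p.2, h⟩, Finset.mem_filter.2 ⟨Finset.mem_univ _, rfl⟩, rfl⟩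

theorem hasSum_in [Fintype (edges T c)] [DecidableEq (CellPoint T L)] (hc : IsPeriodicKernel T c)
    {α : L → L → ℝ} (hα : IsPeriodicKernel T α) (hα0 : ∀ i j, c i j = 0 → α i j = 0)
    (p : CellPoint T L) :
    HasSum (fun j => α j p) (∑ e with (quotientGraph hL c).tgt e = p, α e.1.1 e.1.2) := by
  classical
  set G := quotientGraph hL c
  set s : Finset (edges T c) := {e | G.tgt e = p}
  have htgt : ∀ e ∈ s, p.1 = translate hL e.1.2 (-G.off e) := fun e he => by
    rw [← translate_tgt, neg_add_cancel, translate_zero, (Finset.mem_filter.1 he).2]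
  have hinj : Set.InjOn (fun e : edges T c => translate hL e.1.1 (-G.off e)) s := by
    intro e he e' he' h
    refine congrArg Prod.fst (edgeTranslate_injective hL (a₁ := (e, -G.off e))
      (a₂ := (e', -G.off e')) (Prod.ext h ?_))
    exact (htgt e he).symm.trans (htgt e' he')
  have hterm : ∀ e ∈ s, α e.1.1 e.1.2 = α (translate hL e.1.1 (-G.off e)) p := fun e he => by
    rw [htgt e he, hα.apply_translate hL]
  rw [Finset.sum_congr rfl hterm, ← Finset.sum_image (f := fun j => α j p) hinj]
  refine hasSum_sum_of_ne_finset_zero fun j hj => hα0 _ _ (by_contra fun h => hj ?_)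
  obtain ⟨⟨e, z⟩, hx⟩ := (mem_range_edgeTranslate hL (x := (j, p.1)) hc).2 h
  have hp : (G.tgt e, z + G.off e) = (p, 0) := (cellEquiv hL).symm.injective
    ((translate_tgt hL e z).trans ((congrArg Prod.snd hx).trans (translate_zero hL p).symm))
  refine Finset.mem_image.2 ⟨e, by simpa [s] using congrArg Prod.fst hp, ?_⟩
  rw [← eq_neg_of_add_eq_zero_left (congrArg Prod.snd hp)]
  exact congrArg Prod.fst hx

theorem isDivergenceFree_iff_isCirculation [Fintype (edges T c)] [Finite (CellPoint T L)]
    (hc : IsPeriodicKernel T c) {α : L → L → ℝ} (hα : IsPeriodicKernel T α)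
    (hα0 : ∀ i j, c i j = 0 → α i j = 0) :
    IsDivergenceFree T α ↔ (quotientGraph hL c).IsCirculation fun e => α e.1.1 e.1.2 := by
  classical
  rw [PeriodicGraph.isCirculation_iff, IsDivergenceFree, ← Subtype.forall (p := fun i : L =>
    (i : Space n) ∈ cube n T) (q := fun p => ∑' j : L, (α j p - α p j) = 0)]
  refine forall_congr' fun p => ?_
  rw [((hasSum_in hL hc hα hα0 p).sub (hasSum_out hL hα0 p)).tsum_eq, sub_eq_zero, eq_comm]

/-- The periodic extension of a function on the edges of the quotient graph, by zero where `c`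
vanishes. -/
def periodicExtension (β : edges T c → ℝ) (i j : L) : ℝ :=
  Function.extend (edgeTranslate hL) (fun x => β x.1) 0 (i, j)

theorem periodicExtension_edgeTranslate (β : edges T c → ℝ)
    (x : edges T c × (Fin (n + 1) → ℤ)) :
    periodicExtension hL β (edgeTranslate hL x).1 (edgeTranslate hL x).2 = β x.1 :=
  (edgeTranslate_injective hL).extend_apply _ _ _

theorem periodicExtension_edge (β : edges T c → ℝ) (e : edges T c) :
    periodicExtension hL β e.1.1 e.1.2 = β e := by
  simpa only [edgeTranslate, translate_zero] using periodicExtension_edgeTranslate hL β (e, 0)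

theorem periodicExtension_of_eq_zero (hc : IsPeriodicKernel T c) (β : edges T c → ℝ) (i j : L)
    (h : c i j = 0) : periodicExtension hL β i j = 0 :=
  Function.extend_apply' _ _ _ fun hx => (mem_range_edgeTranslate hL hc).1 hx h

theorem isPeriodicKernel_periodicExtension (hc : IsPeriodicKernel T c) (β : edges T c → ℝ) :
    IsPeriodicKernel T (periodicExtension hL β) := by
  intro z i j i' j' hi hj
  obtain rfl : i' = translate hL i z := Subtype.ext hi
  obtain rfl : j' = translate hL j z := Subtype.ext hj
  by_cases h : c i j = 0
  · rw [periodicExtension_of_eq_zero hL hc β i j h, periodicExtension_of_eq_zero hL hc β]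
    rwa [hc.apply_translate hL]
  · obtain ⟨⟨e, w⟩, hx⟩ := (mem_range_edgeTranslate hL (x := (i, j)) hc).2 h
    obtain ⟨rfl, rfl⟩ := Prod.ext_iff.1 hx
    rw [periodicExtension_edgeTranslate]
    simpa only [edgeTranslate, translate_translate] using
      periodicExtension_edgeTranslate hL β (e, w + z)

theorem isDivergenceFree_periodicExtension_iff [Fintype (edges T c)] [Finite (CellPoint T L)]
    (hc : IsPeriodicKernel T c) (β : edges T c → ℝ) :
    IsDivergenceFree T (periodicExtension hL β) ↔ (quotientGraph hL c).IsCirculation β := by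
  rw [isDivergenceFree_iff_isCirculation hL hc (isPeriodicKernel_periodicExtension hL hc β)
    (periodicExtension_of_eq_zero hL hc β)]
  simp only [periodicExtension_edge]

theorem mem_divergenceFreeVectors_iff [Fintype (edges T c)] [Finite (CellPoint T L)]
    (hc : IsPeriodicKernel T c) {β : edges T c → ℝ} :
    β ∈ divergenceFreeVectors T c ↔ (quotientGraph hL c).IsCirculation β := by
  constructor
  · rintro ⟨α, hα0, hα, hβ, hdiv⟩
    obtain rfl : β = fun e => α e.1.1 e.1.2 := funext hβ
    exact (isDivergenceFree_iff_isCirculation hL hc hα hα0).1 hdiv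
  · exact fun h => ⟨periodicExtension hL β, periodicExtension_of_eq_zero hL hc β,
      isPeriodicKernel_periodicExtension hL hc β, fun e => (periodicExtension_edge hL β e).symm,
      (isDivergenceFree_periodicExtension_iff hL hc β).2 h⟩

end Translate

/-! ### The homogenized density -/

theorem tendsto_of_forall_eventually_le {ι α β : Type*} [LinearOrder α] [TopologicalSpace α]
    [OrderTopology α] [DenselyOrdered α] [NoMinOrder α] [NoMaxOrder α] [LinearOrder β]
    [TopologicalSpace β] [OrderTopology β] {f : ι → β} {F : Filter ι} {h : α → β} {x : α}
    (hh : ContinuousAt h x) (hlow : ∀ y < x, ∀ᶠ i in F, h y ≤ f i)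
    (hup : ∀ y > x, ∀ᶠ i in F, f i ≤ h y) : Tendsto f F (𝓝 (h x)) := by
  refine tendsto_order.2 ⟨fun b hb => ?_, fun b hb => ?_⟩
  · obtain ⟨y, hby, hyx⟩ := ((eventually_nhdsWithin_of_eventually_nhds
      (hh.eventually_const_lt hb)).and self_mem_nhdsWithin).exists (f := 𝓝[<] x)
    exact (hlow y hyx).mono fun i hi => hby.trans_le hi
  · obtain ⟨y, hyb, hxy⟩ := ((eventually_nhdsWithin_of_eventually_nhds
      (hh.eventually_lt_const hb)).and self_mem_nhdsWithin).exists (f := 𝓝[>] x)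
    exact (hup y hxy).mono fun i hi => hi.trans_lt hyb

section Homogenization

variable {L : Set (Space n)} {c : L → L → ℝ≥0}

variable (T c) in
/-- The linear map that sends a function on the edges to its mean flux. -/
def fluxMap [Fintype (edges T c)] : (edges T c → ℝ) →ₗ[ℝ] Space n :=
  ((T : ℝ) ^ (n + 1))⁻¹ •
    Fintype.linearCombination ℝ fun e : edges T c => (e.1.1 : Space n) - e.1.2

theorem fluxMap_apply [Fintype (edges T c)] (β : edges T c → ℝ) :
    fluxMap T c β = ((T : ℝ) ^ (n + 1))⁻¹ •
      ∑ e : edges T c, β e • ((e.1.1 : Space n) - e.1.2) := rfl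

variable [NeZero T]

theorem meanFlux_eq_fluxMap (hL : IsPeriodicSet T L) [Fintype (edges T c)]
    [Finite (CellPoint T L)] {α : L → L → ℝ}
    (hα0 : ∀ i j, c i j = 0 → α i j = 0) :
    meanFlux T α = fluxMap T c fun e => α e.1.1 e.1.2 := by
  classical
  have := Fintype.ofFinite (CellPoint T L)
  have hout (p : CellPoint T L) := (hasSum_out hL (F := fun i j => α i j • ((i : Space n) - j))
    (fun i j h => by rw [hα0 i j h, zero_smul]) p).tsum_eq
  rw [meanFlux, fluxMap_apply, tsum_fintype, Finset.sum_congr rfl fun p _ => hout p,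
    Finset.sum_fiberwise]

variable (hL : IsPeriodicSet T L)

/-- The mean fluxes of the circulations below the capacities. -/
def fluxSet (c : L → L → ℝ≥0) [Fintype (edges T c)] : Set (Space n) :=
  fluxMap T c '' boxSection (quotientGraph hL c).circulations (quotientGraph hL c).cap

section FluxSet

variable [Fintype (edges T c)]

theorem isCompact_fluxSet : IsCompact (fluxSet hL c) :=
  (isCompact_boxSection _ _).image (LinearMap.continuous_of_finiteDimensional _)

theorem convex_fluxSet : Convex ℝ (fluxSet hL c) :=
  (convex_boxSection _ _).linear_image _

theorem zero_mem_fluxSet : 0 ∈ fluxSet hL c :=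
  ⟨0, ⟨Submodule.zero_mem _, fun e _ => ⟨le_rfl, (quotientGraph hL c).cap_nonneg e⟩⟩, map_zero _⟩

theorem encard_extremePoints_fluxSet_le :
    ((fluxSet hL c).extremePoints ℝ).encard ≤ 3 ^ Fintype.card (edges T c) :=
  encard_extremePoints_image_boxSection_le _ _ _

theorem isPolytope_fluxSet : IsPolytope (fluxSet hL c) := by
  have hfin : ((fluxSet hL c).extremePoints ℝ).Finite :=
    Set.finite_of_encard_le_coe (k := 3 ^ Fintype.card (edges T c))
      (by exact_mod_cast encard_extremePoints_fluxSet_le hL)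
  exact ⟨_, hfin, (convexHull_extremePoints_of_finite (isCompact_fluxSet hL) (convex_fluxSet hL)
    hfin).symm⟩

theorem meanFlux_mem_fluxSet [Finite (CellPoint T L)] (hc : IsPeriodicKernel T c)
    {α : L → L → ℝ} (hα : α ∈ admissibleFluxes T c) : meanFlux T α ∈ fluxSet hL c := by
  obtain ⟨hbounds, hper, hdiv⟩ := hα
  have hα0 (i j) (h : c i j = 0) : α i j = 0 :=
    le_antisymm (by simpa [h] using (hbounds i j).2) (hbounds i j).1
  exact ⟨_, ⟨(isDivergenceFree_iff_isCirculation hL hc hper hα0).1 hdiv, fun e _ => hbounds _ _⟩,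
    (meanFlux_eq_fluxMap hL hα0).symm⟩

theorem periodicExtension_mem_admissibleFluxes [Finite (CellPoint T L)]
    (hc : IsPeriodicKernel T c) {β : edges T c → ℝ}
    (hβ : β ∈ boxSection (quotientGraph hL c).circulations (quotientGraph hL c).cap) :
    periodicExtension hL β ∈ admissibleFluxes T c := by
  refine ⟨fun i j => ?_, isPeriodicKernel_periodicExtension hL hc β,
    (isDivergenceFree_periodicExtension_iff hL hc β).2 hβ.1⟩
  by_cases h : c i j = 0
  · rw [periodicExtension_of_eq_zero hL hc β i j h]
    exact ⟨le_rfl, NNReal.coe_nonneg _⟩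
  · obtain ⟨⟨e, z⟩, hx⟩ := (mem_range_edgeTranslate hL (x := (i, j)) hc).2 h
    obtain ⟨rfl, rfl⟩ := Prod.ext_iff.1 hx
    rw [periodicExtension_edgeTranslate]
    simp only [edgeTranslate, hc.apply_translate hL]
    exact hβ.2 e trivial

theorem image_meanFlux_admissibleFluxes [Finite (CellPoint T L)] (hc : IsPeriodicKernel T c) :
    meanFlux T '' admissibleFluxes T c = fluxSet hL c := by
  refine Set.Subset.antisymm (Set.image_subset_iff.2 fun α => meanFlux_mem_fluxSet hL hc)
    (Set.image_subset_iff.2 fun β hβ =>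
      ⟨_, periodicExtension_mem_admissibleFluxes hL hc hβ, ?_⟩)
  rw [meanFlux_eq_fluxMap hL (periodicExtension_of_eq_zero hL hc β)]
  simp only [periodicExtension_edge]

end FluxSet

section CellEnergy

variable {U : Space n ≃ₗᵢ[ℝ] Space n} {ν : Space n} {δ S g : ℝ}

theorem level_zero_quotientGraph (hU : U (lastBasisVector n) = ν) (p : CellPoint T L)
    (z : Fin (n + 1) → ℤ) :
    (quotientGraph hL c).level T U 0 p z = halfSpaceIndicator ν (translate hL p z) := by
  simp only [PeriodicGraph.level, Pi.zero_apply, add_zero, height_eq_inner hU]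
  rfl

theorem mem_competitors {v : CellPoint T L → (Fin (n + 1) → ℤ) → ℝ}
    (hU : U (lastBasisVector n) = ν) (hv01 : ∀ p z, v p z = 0 ∨ v p z = 1)
    (hv : ∀ p z, (quotientGraph hL c).loc T p z ∉ rotatedCube U ((1 - δ) * S) →
      v p z = (quotientGraph hL c).level T U 0 p z) :
    (fun i => v (cellEquiv hL i).1 (cellEquiv hL i).2) ∈ competitors L U ν δ S := by
  refine ⟨fun i => hv01 _ _, fun i hi => ?_⟩
  have hloc : (quotientGraph hL c).loc T (cellEquiv hL i).1 (cellEquiv hL i).2 = i :=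
    congrArg Subtype.val (translate_cellEquiv hL i)
  refine (hv _ _ (hloc ▸ hi)).trans ?_
  rw [level_zero_quotientGraph hL hU, translate_cellEquiv]

variable [Fintype (edges T c)]

theorem inner_fluxMap (hU : U (lastBasisVector n) = ν) (β : edges T c → ℝ) :
    inner ℝ ν (fluxMap T c β) = (quotientGraph hL c).fluxDensity T U β := by
  simp only [fluxMap_apply, inner_smul_right, inner_sum, PeriodicGraph.fluxDensity,
    height_eq_inner hU, disp_quotientGraph, div_eq_inv_mul]

theorem ofReal_le_cellEnergy (hc : IsPeriodicKernel T c) (hS : 0 < S)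
    (h : ∀ u ∈ competitors L U ν δ S, g ≤ (quotientGraph hL c).graphEnergy T
      (fun p z => u (translate hL p z)) (rotatedCube U S) / S ^ n) :
    ENNReal.ofReal g ≤ cellEnergy c U ν δ S := by
  have hSn : 0 < S ^ n := pow_pos hS n
  rw [cellEnergy, ENNReal.le_div_iff_mul_le (.inl (by simpa using hSn))
    (.inl ENNReal.ofReal_ne_top), ← ENNReal.ofReal_mul' hSn.le]
  refine le_iInf₂ fun u hu => ?_
  rw [energy_eq_graphEnergy hL hc u (isBounded_rotatedCube U S)]
  exact ENNReal.ofReal_le_ofReal ((le_div_iff₀ hSn).1 (h u hu))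

theorem cellEnergy_le_ofReal (hc : IsPeriodicKernel T c) (hS : 0 < S) {u : L → ℝ}
    (hu : u ∈ competitors L U ν δ S) :
    cellEnergy c U ν δ S ≤ ENNReal.ofReal ((quotientGraph hL c).graphEnergy T
      (fun p z => u (translate hL p z)) (rotatedCube U S) / S ^ n) := by
  rw [ENNReal.ofReal_div_of_pos (pow_pos hS n),
    ← energy_eq_graphEnergy hL hc u (isBounded_rotatedCube U S)]
  exact ENNReal.div_le_div_right (iInf₂_le u hu) _

theorem eventually_ofReal_le_cellEnergy (hc : IsPeriodicKernel T c)
    (hU : U (lastBasisVector n) = ν) (hδ0 : 0 < δ) (hδ1 : δ < 1)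
    (hg : g < (1 - δ) ^ n * supportFunction (fluxSet hL c) ν +
      (1 - (1 - δ) ^ n) * (quotientGraph hL c).halfSpaceDensity T U) :
    ∀ᶠ S in atTop, ENNReal.ofReal g ≤ cellEnergy c U ν δ S := by
  have hl : 0 < 1 - δ := sub_pos.2 hδ1
  rw [← sub_lt_iff_lt_add, ← div_lt_iff₀' (pow_pos hl n), lt_isLUB_iff
    (isLUB_supportFunction (isCompact_fluxSet hL) ⟨0, zero_mem_fluxSet hL⟩ ν)] at hg
  obtain ⟨_, ⟨_, ⟨β, hβ, rfl⟩, rfl⟩, hgβ⟩ := hg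
  beta_reduce at hgβ
  rw [inner_fluxMap hL hU, div_lt_iff₀' (pow_pos hl n), sub_lt_iff_lt_add] at hgβ
  filter_upwards [eventually_gt_atTop 0, PeriodicGraph.eventually_lt_graphEnergy hβ.1
    (fun e => (hβ.2 e trivial).1) (fun e => (hβ.2 e trivial).2) hl (sub_lt_self 1 hδ0) hgβ]
    with S hS hlow
  refine ofReal_le_cellEnergy hL hc hS fun u hu => (hlow _ fun p z hz => ?_).le
  rw [level_zero_quotientGraph hL hU]
  exact hu.2 _ hz

theorem exists_potentialDensity_le [Finite (CellPoint T L)] (hU : U (lastBasisVector n) = ν)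
    (hg : supportFunction (fluxSet hL c) ν < g) :
    ∃ q, (quotientGraph hL c).potentialDensity T U q ≤ g := by
  have hTn : (0 : ℝ) < (T : ℝ) ^ (n + 1) := pow_pos (Nat.cast_pos.2 (NeZero.pos T)) _
  have hweak : ∀ β ∈ Set.Icc 0 (quotientGraph hL c).cap, (quotientGraph hL c).IsCirculation β →
      ∑ e, β e * height U ((quotientGraph hL c).disp T e) ≤
        supportFunction (fluxSet hL c) ν * T ^ (n + 1) := by
    intro β hβ hcirc
    rw [← div_le_iff₀ hTn, ← PeriodicGraph.fluxDensity, ← inner_fluxMap hL hU]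
    exact inner_le_supportFunction (isCompact_fluxSet hL)
      ⟨β, ⟨hcirc, fun e _ => ⟨hβ.1 e, hβ.2 e⟩⟩, rfl⟩ ν
  obtain ⟨q, hq⟩ := (quotientGraph hL c).exists_potential _ hweak (mul_lt_mul_of_pos_right hg hTn)
  exact ⟨q, (div_le_iff₀ hTn).2 hq⟩

theorem eventually_cellEnergy_le_ofReal [Finite (CellPoint T L)] (hc : IsPeriodicKernel T c)
    (hU : U (lastBasisVector n) = ν) (hδ0 : 0 < δ) (hδ1 : δ < 1)
    (hg : (1 - δ) ^ n * supportFunction (fluxSet hL c) ν +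
      (1 - (1 - δ) ^ n) * (quotientGraph hL c).halfSpaceDensity T U < g) :
    ∀ᶠ S in atTop, cellEnergy c U ν δ S ≤ ENNReal.ofReal g := by
  have hl : 0 < 1 - δ := sub_pos.2 hδ1
  rw [← lt_sub_iff_add_lt, ← lt_div_iff₀' (pow_pos hl n)] at hg
  obtain ⟨m, hm, hmg⟩ := exists_between hg
  obtain ⟨q, hq⟩ := exists_potentialDensity_le hL hU hm
  replace hmg := hq.trans_lt hmg
  rw [lt_div_iff₀' (pow_pos hl n), lt_sub_iff_add_lt] at hmg
  filter_upwards [eventually_gt_atTop 0,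
    PeriodicGraph.eventually_exists_graphEnergy_lt q hl (sub_lt_self 1 hδ0) hmg] with S hS hup
  obtain ⟨v, hv01, hv, hvg⟩ := hup
  refine (cellEnergy_le_ofReal hL hc hS (mem_competitors hL hU hv01 hv)).trans
    (ENNReal.ofReal_le_ofReal ?_)
  simpa only [cellEquiv_translate] using hvg.le

end CellEnergy

theorem isHomogenizedDensity_supportFunction [Fintype (edges T c)] [Finite (CellPoint T L)]
    (hc : IsPeriodicKernel T c) {rot : Space n → Space n ≃ₗᵢ[ℝ] Space n}
    (hrot : ∀ ν, ‖ν‖ = 1 → rot ν (lastBasisVector n) = ν) :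
    IsHomogenizedDensity c rot (supportFunction (fluxSet hL c)) where
  nonneg ν := by
    simpa using inner_le_supportFunction (isCompact_fluxSet (c := c) hL) (zero_mem_fluxSet hL) ν
  convex := convexOn_supportFunction (isCompact_fluxSet hL) ⟨0, zero_mem_fluxSet hL⟩
  homogeneous t ν ht := supportFunction_smul ht.le ν
  cell_formula ν hν := by
    refine ⟨_, fun δ hδ0 hδ1 => tendsto_of_forall_eventually_le
      (ENNReal.continuous_ofReal.continuousAt)
      (fun g => eventually_ofReal_le_cellEnergy hL hc (hrot ν hν) hδ0 hδ1)
      (fun g => eventually_cellEnergy_le_ofReal hL hc (hrot ν hν) hδ0 hδ1), ?_⟩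
    have hcont : Continuous fun δ : ℝ => ENNReal.ofReal ((1 - δ) ^ n *
        supportFunction (fluxSet hL c) ν +
        (1 - (1 - δ) ^ n) * (quotientGraph hL c).halfSpaceDensity T (rot ν)) :=
      ENNReal.continuous_ofReal.comp (by fun_prop)
    simpa using (hcont.tendsto 0).mono_left nhdsWithin_le_nhds

end Homogenization

section Uniqueness

variable {L : Set (Space n)} {c : L → L → ℝ≥0} {rot : Space n → Space n ≃ₗᵢ[ℝ] Space n}
  {φ φ' : Space n → ℝ}

theorem IsHomogenizedDensity.eq_of_norm_eq_one (h : IsHomogenizedDensity c rot φ)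
    (h' : IsHomogenizedDensity c rot φ') {ν : Space n} (hν : ‖ν‖ = 1) : φ ν = φ' ν := by
  obtain ⟨g, hg, hgφ⟩ := h.cell_formula ν hν
  obtain ⟨g', hg', hgφ'⟩ := h'.cell_formula ν hν
  have heq : g =ᶠ[𝓝[>] 0] g' := by
    filter_upwards [Ioo_mem_nhdsGT (zero_lt_one (α := ℝ))] with δ hδ
    exact tendsto_nhds_unique (hg δ hδ.1 hδ.2) (hg' δ hδ.1 hδ.2)
  exact (ENNReal.ofReal_eq_ofReal_iff (h.nonneg ν) (h'.nonneg ν)).1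
    (tendsto_nhds_unique (hgφ.congr' heq) hgφ')

theorem IsHomogenizedDensity.map_zero (h : IsHomogenizedDensity c rot φ) : φ 0 = 0 := by
  have := h.homogeneous 2 0 two_pos
  rw [smul_zero] at this
  linarith

theorem IsHomogenizedDensity.eq (h : IsHomogenizedDensity c rot φ)
    (h' : IsHomogenizedDensity c rot φ') : φ = φ' := by
  funext ν
  rcases eq_or_ne ν 0 with rfl | hν
  · rw [h.map_zero, h'.map_zero]
  · have hunit : ‖‖ν‖⁻¹ • ν‖ = 1 := norm_smul_inv_norm (𝕜 := ℝ) hν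
    have hpos : 0 < ‖ν‖ := norm_pos_iff.2 hν
    rw [← smul_inv_smul₀ hpos.ne' ν, h.homogeneous _ _ hpos, h'.homogeneous _ _ hpos,
      h.eq_of_norm_eq_one h' hunit]

end Uniqueness

end LatticeEnergy

end

theorem theorem2p7 {n : ℕ} (T : ℕ) (hT : 0 < T)
    (L : Set (LatticeEnergy.Space n))
    (hL1 : LatticeEnergy.IsDiscreteSet L)
    (hL2 : LatticeEnergy.IsPeriodicSet T L)
    (c : L → L → ℝ≥0)
    (hH1 : LatticeEnergy.IsPeriodicKernel T c)
    (hH3 : LatticeEnergy.HasFiniteRange c)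
    (rot : LatticeEnergy.Space n → LatticeEnergy.Space n ≃ₗᵢ[ℝ] LatticeEnergy.Space n)
    (hrot : ∀ ν, ‖ν‖ = 1 → rot ν (LatticeEnergy.lastBasisVector n) = ν) :
    (∃! φ : LatticeEnergy.Space n → ℝ, LatticeEnergy.IsHomogenizedDensity c rot φ) ∧
    ∀ φ : LatticeEnergy.Space n → ℝ, LatticeEnergy.IsHomogenizedDensity c rot φ →
      LatticeEnergy.IsCrystalline φ ∧
      (LatticeEnergy.edges T c).Finite ∧
      (Set.extremePoints ℝ (LatticeEnergy.wulffSet φ)).encard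
        ≤ ((3 ^ (LatticeEnergy.edges T c).ncard : ℕ) : ℕ∞) ∧
      (∀ ν, IsLUB ((fun α => inner ℝ ν (LatticeEnergy.meanFlux T α)) ''
        LatticeEnergy.admissibleFluxes T c) (φ ν)) ∧
      ∃ (V : Submodule ℝ (LatticeEnergy.edges T c → ℝ))
        (Λ : (LatticeEnergy.edges T c → ℝ) →ₗ[ℝ] LatticeEnergy.Space n),
        (V : Set (LatticeEnergy.edges T c → ℝ)) = LatticeEnergy.divergenceFreeVectors T c ∧
        (∀ β, Λ β = ((T : ℝ) ^ (n + 1))⁻¹ • ∑ᶠ e : LatticeEnergy.edges T c,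
          β e • ((e.1.1 : LatticeEnergy.Space n) - (e.1.2 : LatticeEnergy.Space n))) ∧
        LatticeEnergy.wulffSet φ =
          Λ '' ((V : Set (LatticeEnergy.edges T c → ℝ)) ∩
            Set.univ.pi fun e => Set.Icc (0 : ℝ) (c e.1.1 e.1.2)) := by
  have : NeZero T := ⟨hT.ne'⟩
  have hfin := LatticeEnergy.finite_edges hL1 hH3 T
  have := hfin.fintype
  have := hL1.finite_cellPoint T
  have hφ₀ := LatticeEnergy.isHomogenizedDensity_supportFunction hL2 hH1 hrot
  have hwulff := LatticeEnergy.wulffSet_supportFunction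
    (LatticeEnergy.isCompact_fluxSet (c := c) hL2) (LatticeEnergy.convex_fluxSet hL2)
    ⟨0, LatticeEnergy.zero_mem_fluxSet hL2⟩
  refine ⟨⟨_, hφ₀, fun φ hφ => hφ.eq hφ₀⟩, fun φ hφ => ?_⟩
  obtain rfl := hφ.eq hφ₀
  refine ⟨?_, hfin, ?_, fun ν => ?_, (LatticeEnergy.quotientGraph hL2 c).circulations,
    LatticeEnergy.fluxMap T c,
    Set.ext fun β => (LatticeEnergy.mem_divergenceFreeVectors_iff hL2 hH1).symm,
    fun β => by rw [LatticeEnergy.fluxMap_apply, finsum_eq_sum_of_fintype], hwulff⟩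
  · rw [LatticeEnergy.IsCrystalline, hwulff]
    exact LatticeEnergy.isPolytope_fluxSet hL2
  · rw [hwulff, ← Nat.card_coe_set_eq, Nat.card_eq_fintype_card]
    exact_mod_cast LatticeEnergy.encard_extremePoints_fluxSet_le hL2
  · rw [← Set.image_image, LatticeEnergy.image_meanFlux_admissibleFluxes hL2 hH1]
    exact LatticeEnergy.isLUB_supportFunction (LatticeEnergy.isCompact_fluxSet hL2)
      ⟨0, LatticeEnergy.zero_mem_fluxSet hL2⟩ ν
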